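/- **Setting.** An instance of two-stage stochastic metric uncapacitated facility location with explicit scenarios consists of finite sets of facilities $\mathcal F$ and clients $\mathcal C$ located in a (pseudo)metric space, with $c_{ij}$ the distance between facility $i$ and client $j$; a finite family of scenarios $A$, each with a set of active clients (also written $A$) and a probability $p_A\ge 0$, $\sum_A p_A=1$; and opening costs $f_i^I\ge 0$ (first stage) and $f_i^A\ge 0$ (second stage of scenario $A$). The LP relaxation is $$\min\ \sum_i f_i^I y_i+\sum_A p_A\Big(\sum_i f_i^A y_{A,i}+\sum_{j\in A}\sum_i c_{ij}x_{A,ij}\Big)$$ subject to $\sum_i x_{A,ij}\ge 1$, $x_{A,ij}\le y_i+y_{A,i}$ and $x_{A,ij},y_i,y_{A,i}\ge 0$ for all $i$, $A$, $j\in A$. The dual is to maximize $\sum_A p_A\sum_{j\in A}v_{j,A}$ subject to $w_{ij,A}\ge v_{j,A}-c_{ij}$, $\ \sum_A p_A\sum_{j\in A}w_{ij,A}\le f_i^I$, $\ \sum_{j\in A}w_{ij,A}\le f_i^A$, and $v,w\ge 0$. For an optimal primal solution $(x^*,y^*)$ and an optimal dual solution $(v^*,w^*)$ put $F_A=\sum_i(f_i^Iy_i^*+f_i^Ay_{A,i}^*)$,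 $C_A=\sum_{j\in A}\sum_i c_{ij}x^*_{A,ij}$, $V_A=\sum_{j\in A}v^*_{j,A}$, $F^*=\sum_i f_i^I y_i^*+\sum_A p_A\sum_i f_i^Ay^*_{A,i}$, $C^*=\sum_A p_AC_A$. **Algorithm**, on input an optimal primal solution $(x^*,y^*)$. 1. *Scale and split.* Multiply all variables by 2 and replace facilities by copies, distributing the opening and assignment values of a facility over its copies, to obtain $(\overline x,\overline y)\ge 0$ such that: no copy has both $\overline y_i\neq 0$ and $\overline y_{A,i}\ne 0$ for some $A$; all $\overline y_i,\overline y_{A,i}\le 1$; and always $\overline x_{A,ij}=0$ or $\overline x_{A,ij}=\overline y_i+\overline y_{A,i}$. Let $\overline x^{(I)}_{A,ij}=\min\{\overline x_{A,ij},\overline y_i\}$ and $\overline x^{(II)}_{A,ij}=\overline x_{A,ij}-\overline x^{(I)}_{A,ij}$. 2. *Cluster candidates.* A pair $(j,A)$ with $j\in A$ is in $S$ (first stage served) if $\sum_i\overline x^{(I)}_{A,ij}\ge 1$. For $(j,A)\in S$ choose a set $F_{(j,A)}$ of copies with $\sum_{i\in F_{(j,A)}}\overline x^{(I)}_{A,ij}=1$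 and $0<\overline x^{(I)}_{A,ij}=\overline y_i$ for all $i\in F_{(j,A)}$; for $(j,A)\notin S$ choose it with $\sum_{i\in F_{(j,A)}}\overline x^{(II)}_{A,ij}=1$ and $0<\overline x^{(II)}_{A,ij}=\overline y_{A,i}$ for all $i\in F_{(j,A)}$. (The splitting in step 1 is made fine enough for these sets to exist.) Let $R_{(j,A)}=\max_{i\in F_{(j,A)}}c_{ij}$. 3. *Greedy clustering.* In Stage I go through all pairs in $S$, and in Stage II of scenario $A$ through all pairs $(j,A)\notin S$ with $j\in A$, in an order of non-decreasing $R_{(j,A)}$; make $F_{(j,A)}$ a cluster if it is disjoint from all clusters formed before in that stage. 4. *Rounding.* In each stage, open in each cluster exactly one copy, chosen with probability equal to its fractional opening ($\overline y_i$ in Stage I, $\overline y_{A,i}$ in Stage II of scenario $A$), and open each unclustered copy with probability equal to its fractional opening; all these choices, and the two stages, are independent. A facility is open if one of its copies is. In scenario $A$ connect every client $j\in A$ to a closest facility opened in Stage I or in Stage II of $A$. Let $\mathrm{COST}(A)$ be the cost of the facilities opened in Stage I and in Stage II of $A$ plus the connection cost of the clients in $A$, and let $E[\mathrm{COST}]=\sum_A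 p_A E[\mathrm{COST}(A)]$ be the total expected cost. **Claim.** For every instance and every optimal primal solution, the algorithm can be carried out. Moreover, for every choice of the splitting, of the sets $F_{(j,A)}$ and of the orders (ties) in step 3, the following hold: with probability 1, in every scenario with an active client some facility is open; for every optimal dual solution and every scenario $A$ with $p_A>0$, $$E[\mathrm{COST}(A)]\le 3e^{-2}V_A+(1-e^{-2})C_A+2F_A;$$ and $$E[\mathrm{COST}]\le(2+3e^{-2})F^*+(1+2e^{-2})C^*\le 2.4061\,F^*+1.2707\,C^*.$$ -/

import Mathlib

universe u v

namespace StochUFL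

/-- An instance of two-stage stochastic metric uncapacitated facility location with explicitly
given scenarios: facilities `F`, clients `C`, scenarios `S`; facilities and clients are points of a
(pseudo)metric space `X`. -/
structure Problem (F C S : Type u) [Fintype F] [Fintype C] [Fintype S]
    (X : Type v) [PseudoMetricSpace X] where
  /-- position of a facility -/
  facLoc : F → X
  /-- position of a client -/
  cliLoc : C → X
  /-- the clients that are active in a scenario -/
  clients : S → Finset C
  /-- the probability of a scenario -/
  prob : S → ℝ
  prob_nonneg : ∀ A, 0 ≤ prob A
  prob_sum : ∑ A, prob A = 1
  /-- first-stage opening costs -/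
  openI : F → ℝ
  openI_nonneg : ∀ i, 0 ≤ openI i
  /-- second-stage opening costs, which may depend on the scenario -/
  openII : S → F → ℝ
  openII_nonneg : ∀ A i, 0 ≤ openII A i

/-- A vector of primal variables: `yI i` is `y_i`, `yII A i` is `y_{A,i}` and
`x A i j` is `x_{A,ij}`. The values `x A i j` with `j` not active in `A` play no role. -/
structure Sol (F C S : Type u) where
  yI : F → ℝ
  yII : S → F → ℝ
  x : S → F → C → ℝ

/-- A vector of dual variables: `v A j` is `v_{j,A}` and `w A i j` is `w_{ij,A}`. -/
structure DualSol (F C S : Type u) where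
  v : S → C → ℝ
  w : S → F → C → ℝ

section Programs

variable {F C S : Type u} [Fintype F] [Fintype C] [Fintype S] {X : Type v} [PseudoMetricSpace X]

/-- The connection cost `c_{ij}`. -/
noncomputable def Problem.c (I : Problem F C S X) (i : F) (j : C) : ℝ :=
  dist (I.facLoc i) (I.cliLoc j)

/-- The fractional opening cost `F_A` in scenario `A`, over both stages. -/
noncomputable def Problem.facCost (I : Problem F C S X) (s : Sol F C S) (A : S) : ℝ :=
  ∑ i, (I.openI i * s.yI i + I.openII A i * s.yII A i)

/-- The fractional connection cost `C_A` in scenario `A`. -/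
noncomputable def Problem.conCost (I : Problem F C S X) (s : Sol F C S) (A : S) : ℝ :=
  ∑ j ∈ I.clients A, ∑ i, I.c i j * s.x A i j

/-- The total (expected over scenarios) fractional opening cost. -/
noncomputable def Problem.totalFac (I : Problem F C S X) (s : Sol F C S) : ℝ :=
  ∑ i, I.openI i * s.yI i + ∑ A, I.prob A * ∑ i, I.openII A i * s.yII A i

/-- The total (expected over scenarios) fractional connection cost. -/
noncomputable def Problem.totalCon (I : Problem F C S X) (s : Sol F C S) : ℝ :=
  ∑ A, I.prob A * ∑ j ∈ I.clients A, ∑ i, I.c i j * s.x A i j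

/-- Feasibility for the primal linear program. -/
structure Problem.PrimalFeasible (I : Problem F C S X) (s : Sol F C S) : Prop where
  covered : ∀ A, ∀ j ∈ I.clients A, 1 ≤ ∑ i, s.x A i j
  le_open : ∀ A i, ∀ j ∈ I.clients A, s.x A i j ≤ s.yI i + s.yII A i
  x_nonneg : ∀ A i, ∀ j ∈ I.clients A, 0 ≤ s.x A i j
  yI_nonneg : ∀ i, 0 ≤ s.yI i
  yII_nonneg : ∀ A i, 0 ≤ s.yII A i

/-- Optimality for the primal linear program. -/
def Problem.PrimalOptimal (I : Problem F C S X) (s : Sol F C S) : Prop :=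
  I.PrimalFeasible s ∧
    ∀ t, I.PrimalFeasible t → I.totalFac s + I.totalCon s ≤ I.totalFac t + I.totalCon t

/-- The dual budget `V_A` of scenario `A`. -/
noncomputable def Problem.budget (I : Problem F C S X) (d : DualSol F C S) (A : S) : ℝ :=
  ∑ j ∈ I.clients A, d.v A j

/-- Feasibility for the dual linear program. -/
structure Problem.DualFeasible (I : Problem F C S X) (d : DualSol F C S) : Prop where
  w_ge : ∀ A i, ∀ j ∈ I.clients A, d.v A j - I.c i j ≤ d.w A i j
  first_le : ∀ i, ∑ A, I.prob A * ∑ j ∈ I.clients A, d.w A i j ≤ I.openI i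
  second_le : ∀ A i, ∑ j ∈ I.clients A, d.w A i j ≤ I.openII A i
  w_nonneg : ∀ A i, ∀ j ∈ I.clients A, 0 ≤ d.w A i j
  v_nonneg : ∀ A, ∀ j ∈ I.clients A, 0 ≤ d.v A j

/-- Optimality for the dual linear program. -/
def Problem.DualOptimal (I : Problem F C S X) (d : DualSol F C S) : Prop :=
  I.DualFeasible d ∧
    ∀ e, I.DualFeasible e → ∑ A, I.prob A * I.budget e A ≤ ∑ A, I.prob A * I.budget d A

end Programs

section Splitting

variable {F C S : Type u} [Fintype F] [Fintype C] [Fintype S] {X : Type v} [PseudoMetricSpace X]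

/-- `t` is obtained from the fractional solution `s` by scaling all variables by 2 and splitting
facilities: `G` is the set of copies, `proj g` is the facility of which `g` is a copy. -/
structure Problem.IsScaledSplit [DecidableEq F] (I : Problem F C S X) (s : Sol F C S)
    {G : Type u} [Fintype G] (proj : G → F) (t : Sol G C S) : Prop where
  x_nonneg : ∀ A g, ∀ j ∈ I.clients A, 0 ≤ t.x A g j
  yI_nonneg : ∀ g, 0 ≤ t.yI g
  yII_nonneg : ∀ A g, 0 ≤ t.yII A g
  yI_sum : ∀ i, ∑ g with proj g = i, t.yI g = 2 * s.yI i
  yII_sum : ∀ A i, ∑ g with proj g = i, t.yII A g = 2 * s.yII A i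
  x_sum : ∀ A i, ∀ j ∈ I.clients A, ∑ g with proj g = i, t.x A g j = 2 * s.x A i j
  /-- no copy is fractionally opened in both stages -/
  one_stage : ∀ g, t.yI g = 0 ∨ ∀ A, t.yII A g = 0
  yI_le_one : ∀ g, t.yI g ≤ 1
  yII_le_one : ∀ A g, t.yII A g ≤ 1
  /-- a copy that serves a client is completely used by it -/
  complete : ∀ A g, ∀ j ∈ I.clients A, t.x A g j = 0 ∨ t.x A g j = t.yI g + t.yII A g

end Splitting

section Stages

variable {G C S : Type u}

/-- First-stage part of the assignment, `min {x_{A,gj}, y_g}`. -/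
noncomputable def Sol.xI (t : Sol G C S) (A : S) (g : G) (j : C) : ℝ := min (t.x A g j) (t.yI g)

/-- Second-stage part of the assignment. -/
noncomputable def Sol.xII (t : Sol G C S) (A : S) (g : G) (j : C) : ℝ := t.x A g j - t.xI A g j

/-- The client-scenario pair `(j, A)` is first stage served. -/
def Sol.FirstServed [Fintype G] (t : Sol G C S) (A : S) (j : C) : Prop := 1 ≤ ∑ g, t.xI A g j

end Stages

section Rounding

variable {G P : Type u} [Fintype G] [DecidableEq G]

/-- Greedy clustering: go through the list in its order; `p` becomes a cluster center iff `cand p`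
is disjoint from all clusters formed before. -/
def greedyList (cand : P → Finset G) (l : List P) : List P :=
  l.foldl (fun K p => if ∀ q ∈ K, Disjoint (cand p) (cand q) then K ++ [p] else K) []

/-- The set of cluster centers found by greedy clustering; the clusters are their `cand` sets. -/
def greedyCenters [DecidableEq P] (cand : P → Finset G) (l : List P) : Finset P := (greedyList cand l).toFinset

/-- The random draws of one stage: one facility for every cluster, and a coin for every
facility (the coin of a clustered facility is ignored). -/
abbrev Draws (G : Type u) {P : Type u} (centers : Finset P) : Type u :=
  ({p // p ∈ centers} → G) × (G → Bool)

/-- Probability of an outcome: all draws are independent, cluster `cand p` draws `g ∈ cand p` with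
probability `m g`, and the coin of `g` shows `true` with probability `m g`. -/
noncomputable def drawProb (m : G → ℝ) (cand : P → Finset G) (centers : Finset P)
    (ω : Draws G centers) : ℝ :=
  (∏ p : {p // p ∈ centers}, if ω.1 p ∈ cand p then m (ω.1 p) else 0) *
    ∏ g, if ω.2 g = true then m g else 1 - m g

/-- The facilities opened in one stage: those drawn by the clusters, and the unclustered ones whose
coin shows `true`. -/
def opened (cand : P → Finset G) (centers : Finset P) (ω : Draws G centers) : Finset G :=
  Finset.univ.filter fun g =>
    (∃ p, ω.1 p = g) ∨ ((∀ p ∈ centers, g ∉ cand p) ∧ ω.2 g = true)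

theorem drawProb_nonneg (m : G → ℝ) (cand : P → Finset G) (centers : Finset P)
    (h0 : ∀ g, 0 ≤ m g) (h1 : ∀ g, m g ≤ 1) (ω : Draws G centers) :
    0 ≤ drawProb m cand centers ω := by
  refine mul_nonneg (Finset.prod_nonneg fun p _ => ?_) (Finset.prod_nonneg fun g _ => ?_)
  · split_ifs
    · exact h0 _
    · exact le_rfl
  · split_ifs
    · exact h0 _
    · exact sub_nonneg.2 (h1 _)

/-- The outcome probabilities add up to 1 when each cluster has total fractional opening 1. -/
theorem drawProb_sum [DecidableEq P] (m : G → ℝ) (cand : P → Finset G) (centers : Finset P)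
    (h : ∀ p ∈ centers, ∑ g ∈ cand p, m g = 1) :
    ∑ ω : Draws G centers, drawProb m cand centers ω = 1 := by
  unfold drawProb
  rw [Fintype.sum_prod_type, ← Fintype.sum_mul_sum
    (fun f : {p // p ∈ centers} → G => ∏ p : {p // p ∈ centers}, if f p ∈ cand p then m (f p) else 0)
    (fun b : G → Bool => ∏ g, if b g = true then m g else 1 - m g)]
  have e1 := Finset.prod_univ_sum (fun _ : {p // p ∈ centers} => (Finset.univ : Finset G))
    (fun p g => if g ∈ cand p then m g else (0 : ℝ))
  have e2 := Finset.prod_univ_sum (fun _ : G => (Finset.univ : Finset Bool))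
    (fun g b => if b = true then m g else 1 - m g)
  rw [Fintype.piFinset_univ] at e1 e2
  rw [← e1, ← e2, Finset.prod_eq_one, Finset.prod_eq_one, one_mul]
  · intro g _
    simp
  · intro p _
    rw [← h p.1 p.2]
    simp

end Rounding

section Algorithm

variable {F C S : Type u} [Fintype F] [Fintype C] [Fintype S]
  {X : Type v} [PseudoMetricSpace X]

/-- `R_{(j,A)}`: the largest distance from client `j` to a copy in `K` (which is nonempty in all
uses). -/
noncomputable def Problem.radius (I : Problem F C S X) {G : Type u} (proj : G → F)
    (K : Finset G) (j : C) : ℝ :=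
  if h : K.Nonempty then K.sup' h fun g => I.c (proj g) j else 0

/-- The deterministic part of an execution of the algorithm on the fractional solution `s`:
scaling by 2 and splitting, the choice of the sets `F_{(j,A)}`, and the orders in which the pairs
are considered for clustering. All choices that the algorithm leaves open are arbitrary. -/
structure Execution [DecidableEq F] (I : Problem F C S X) (s : Sol F C S)
    (G : Type u) [Fintype G] where
  proj : G → F
  t : Sol G C S
  split : I.IsScaledSplit s proj t
  /-- `cand (A, j)` is `F_{(j,A)}` -/
  cand : S × C → Finset G
  candI_sum : ∀ A, ∀ j ∈ I.clients A, t.FirstServed A j → ∑ g ∈ cand (A, j), t.xI A g j = 1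
  candI_mem : ∀ A, ∀ j ∈ I.clients A, t.FirstServed A j →
    ∀ g ∈ cand (A, j), 0 < t.xI A g j ∧ t.xI A g j = t.yI g
  candII_sum : ∀ A, ∀ j ∈ I.clients A, ¬ t.FirstServed A j → ∑ g ∈ cand (A, j), t.xII A g j = 1
  candII_mem : ∀ A, ∀ j ∈ I.clients A, ¬ t.FirstServed A j →
    ∀ g ∈ cand (A, j), 0 < t.xII A g j ∧ t.xII A g j = t.yII A g
  /-- the first stage served pairs by non-decreasing radius -/
  orderI : List (S × C)
  orderI_nodup : orderI.Nodup
  orderI_mem : ∀ q, q ∈ orderI ↔ q.2 ∈ I.clients q.1 ∧ t.FirstServed q.1 q.2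
  orderI_sorted : orderI.Pairwise fun q r =>
    I.radius proj (cand q) q.2 ≤ I.radius proj (cand r) r.2
  /-- for every scenario, the other pairs of this scenario by non-decreasing radius -/
  orderII : S → List (S × C)
  orderII_nodup : ∀ A, (orderII A).Nodup
  orderII_mem : ∀ A q, q ∈ orderII A ↔
    q.1 = A ∧ q.2 ∈ I.clients A ∧ ¬ t.FirstServed A q.2
  orderII_sorted : ∀ A, (orderII A).Pairwise fun q r =>
    I.radius proj (cand q) q.2 ≤ I.radius proj (cand r) r.2

variable [DecidableEq F] [DecidableEq C] [DecidableEq S] {I : Problem F C S X} {s : Sol F C S}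
  {G : Type u} [Fintype G] [DecidableEq G]

/-- Centers of the clusters of Stage I. -/
def Execution.centersI (R : Execution I s G) : Finset (S × C) := greedyCenters R.cand R.orderI

/-- Centers of the clusters of Stage II of scenario `A`. -/
def Execution.centersII (R : Execution I s G) (A : S) : Finset (S × C) :=
  greedyCenters R.cand (R.orderII A)

/-- Probability of an outcome of the draws of Stage I. -/
noncomputable def Execution.probI (R : Execution I s G) (ω : Draws G R.centersI) : ℝ :=
  drawProb R.t.yI R.cand R.centersI ω

/-- Probability of an outcome of the draws of Stage II of scenario `A`. -/
noncomputable def Execution.probII (R : Execution I s G) (A : S)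
    (ω : Draws G (R.centersII A)) : ℝ :=
  drawProb (R.t.yII A) R.cand (R.centersII A) ω

/-- The facilities of the original instance that are opened in Stage I. -/
def Execution.openI (R : Execution I s G) (ω : Draws G R.centersI) : Finset F :=
  (opened R.cand R.centersI ω).image R.proj

/-- The facilities of the original instance that are opened in Stage II of scenario `A`. -/
def Execution.openII (R : Execution I s G) (A : S) (ω : Draws G (R.centersII A)) : Finset F :=
  (opened R.cand (R.centersII A) ω).image R.proj

/-- Distance from client `j` to a closest facility in `O` (`0` if `O` is empty). -/
noncomputable def Problem.nearest (I : Problem F C S X) (O : Finset F) (j : C) : ℝ :=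
  if h : O.Nonempty then O.inf' h fun i => I.c i j else 0

/-- The cost in scenario `A` of opening `O₁` in Stage I and `O₂` in Stage II, each active client
being connected to a closest open facility. -/
noncomputable def Problem.roundedCost (I : Problem F C S X) (A : S) (O₁ O₂ : Finset F) : ℝ :=
  ∑ i ∈ O₁, I.openI i + ∑ i ∈ O₂, I.openII A i + ∑ j ∈ I.clients A, I.nearest (O₁ ∪ O₂) j

/-- `E[COST(A)]`: the expected cost in scenario `A`, the draws of the two stages being
independent. -/
noncomputable def Execution.expCostIn (R : Execution I s G) (A : S) : ℝ :=
  ∑ ω₁ : Draws G R.centersI, ∑ ω₂ : Draws G (R.centersII A),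
    R.probI ω₁ * R.probII A ω₂ * I.roundedCost A (R.openI ω₁) (R.openII A ω₂)

/-- The expected cost, over the choice of the scenario and the random choices of the algorithm. -/
noncomputable def Execution.expCost (R : Execution I s G) : ℝ :=
  ∑ A, I.prob A * R.expCostIn A

end Algorithm

end StochUFL

/-! Fix an active client `j` of scenario `A`. Its doubled assignment has total mass `T ≥ 2` over the
copies. For a radius `r`, let `m` be the part of this mass within distance `r`. All copies serving
`j` within distance `r` stay closed with probability at most `exp (-m)`: draws of different clusters
and coins are independent, and one cluster misses a set of mass `t` with probability `1 - t ≤ exp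
(-t)` (`prob_disjoint_opened_le`, `tail_nearest_le`). By convexity `exp (-m)` lies below the chord
`exp (-T) + (1 - exp (-T)) * (1 - m / T)`, and `1 - m / T` is the tail of the distance to a copy
picked proportionally to the assignment.

Doubling gives `j` mass at least 1 in one of the stages, hence a candidate set there. It meets a
cluster of no larger radius, so some copy is open within three times any bound on the distances to
the facilities serving `j`. By complementary slackness `v_{j,A}` is such a bound when `p_A > 0`.
Integrating the tail bound up to `3 * v` gives expected distance at most `3e⁻² v + (1 - e⁻²) ∑ c x`
(`expected_nearest_le`).

Each copy opens with probability at most its fractional opening, which yields `2 * F_A`. Averaging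
over scenarios and bounding the dual value by `F* + C*` gives the total bound. Absence of a duality
gap comes from Lagrange multipliers, obtained by Hahn–Banach separation. An execution exists because
cutting the copies at finitely many breakpoints makes every required set an initial segment of
pieces (`exists_execution`). -/

namespace StochUFL

/-! ### Lagrange multipliers by separation -/

/-- Lagrange duality for finitely many convex constraints under Slater's condition. -/
theorem exists_lagrange_multipliers {E ι : Type*} [AddCommGroup E] [Module ℝ E] [Fintype ι]
    {K : Set E} (obj : E → ℝ) (hobj : ConvexOn ℝ K obj) (h : ι → E → ℝ)
    (hh : ∀ k, ConvexOn ℝ K (h k)) (opt : ℝ)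
    (slater : ∃ x ∈ K, ∀ k, h k x < 0)
    (hopt : ∀ x ∈ K, (∀ k, h k x ≤ 0) → opt ≤ obj x) :
    ∃ l : ι → ℝ, (∀ k, 0 ≤ l k) ∧ ∀ x ∈ K, opt ≤ obj x + ∑ k, l k * h k x := by
  classical
  obtain ⟨x₀, hx₀, hx₀'⟩ := slater
  -- Values strictly above an attainable (constraints, objective) pair. Strictness makes `U` open,
  -- and `hopt` keeps `(0, opt)` outside, so a hyperplane separates them.
  let U : Set ((ι → ℝ) × ℝ) := {q | ∃ x ∈ K, (∀ k, h k x < q.1 k) ∧ obj x < q.2}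
  have hUo : IsOpen U := by
    have : U = ⋃ x ∈ K, ((⋂ k, {q : (ι → ℝ) × ℝ | h k x < q.1 k}) ∩ {q | obj x < q.2}) := by
      ext q
      simp only [U, Set.mem_ofPred_eq, Set.mem_iUnion, Set.mem_inter_iff, Set.mem_iInter,
        exists_prop]
    rw [this]
    refine isOpen_biUnion fun x _ => IsOpen.inter (isOpen_iInter_of_finite fun k => ?_) ?_
    · exact isOpen_lt continuous_const (by fun_prop)
    · exact isOpen_lt continuous_const (by fun_prop)
  have hUc : Convex ℝ U := by
    rintro q ⟨x, hx, hxq, hxo⟩ r ⟨y, hy, hyr, hyo⟩ a b ha hb hab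
    refine ⟨a • x + b • y, hobj.1 hx hy ha hb hab, fun k => ?_, ?_⟩
    · refine ((hh k).2 hx hy ha hb hab).trans_lt ?_
      simp only [smul_eq_mul, Prod.fst_add, Prod.smul_fst, Pi.add_apply, Pi.smul_apply]
      rcases ha.eq_or_lt with rfl | ha
      · have : b = 1 := by linarith
        subst this
        simpa using hyr k
      · have := mul_lt_mul_of_pos_left (hxq k) ha
        have := mul_le_mul_of_nonneg_left (hyr k).le hb
        linarith
    · refine (hobj.2 hx hy ha hb hab).trans_lt ?_
      simp only [smul_eq_mul, Prod.snd_add, Prod.smul_snd]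
      rcases ha.eq_or_lt with rfl | ha
      · have : b = 1 := by linarith
        subst this
        simpa using hyo
      · have := mul_lt_mul_of_pos_left hxo ha
        have := mul_le_mul_of_nonneg_left hyo.le hb
        linarith
  have hU0 : ((0 : ι → ℝ), opt) ∉ U := by
    rintro ⟨x, hx, hxk, hxo⟩
    exact absurd (hopt x hx fun k => (hxk k).le) (not_le.2 hxo)
  obtain ⟨f, hf⟩ := geometric_hahn_banach_point_open hUc hUo hU0
  set m : ℝ := f (0, 1) with hm
  set l : ι → ℝ := fun k => f (Pi.single k 1, 0) with hl
  have hfq : ∀ (u : ι → ℝ) (r : ℝ), f (u, r) = ∑ k, u k * l k + r * m := by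
    intro u r
    have e : ((u, r) : (ι → ℝ) × ℝ)
        = ∑ k, u k • ((Pi.single k 1, 0) : (ι → ℝ) × ℝ) + r • ((0, 1) : (ι → ℝ) × ℝ) := by
      refine Prod.ext ?_ ?_
      · ext k
        simp [Prod.fst_sum, Finset.sum_apply, Pi.single_apply]
      · simp [Prod.snd_sum]
    rw [e, map_add, map_sum, map_smul]
    simp only [map_smul, smul_eq_mul, hl, hm]
  have ray : ∀ a b : ℝ, (∀ t : ℝ, 0 ≤ t → 0 < a + t * b) → 0 ≤ b := by
    intro a b hab
    by_contra! hb
    have h1 := hab (|a| / (-b)) (div_nonneg (abs_nonneg _) (by linarith))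
    have h2 : |a| / (-b) * b = -|a| := by
      rw [div_mul_eq_mul_div, div_neg, mul_div_cancel_right₀ _ hb.ne]
    rw [h2] at h1
    linarith [le_abs_self a]
  -- The Slater point puts `(0, r)` into `U` for large `r`, so the separating hyperplane is not
  -- vertical and `m` can be divided out.
  have hm0 : 0 < m := by
    have h1 := hf (0, max opt (obj x₀) + 1) ⟨x₀, hx₀, hx₀', by
      exact (le_max_right opt (obj x₀)).trans_lt (lt_add_one _)⟩
    rw [hfq, hfq] at h1
    simp only [Pi.zero_apply, zero_mul, Finset.sum_const_zero, zero_add] at h1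
    have h2 : opt < max opt (obj x₀) + 1 := (le_max_left opt (obj x₀)).trans_lt (lt_add_one _)
    nlinarith
  -- Relaxing constraint `k` without limit stays inside `U`, so `f` cannot decrease in that
  -- direction.
  have hl0 : ∀ k, 0 ≤ l k := by
    intro k
    refine ray ((obj x₀ + 1) * m - opt * m) _ fun t ht => ?_
    have h1 := hf (t • Pi.single k 1, obj x₀ + 1) ⟨x₀, hx₀, fun k' => by
      refine (hx₀' k').trans_le ?_
      by_cases hk : k' = k
      · subst hk
        simpa using ht
      · simp [hk], by simp⟩
    rw [hfq, hfq] at h1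
    simp [Pi.single_apply] at h1
    linarith
  refine ⟨fun k => l k / m, fun k => div_nonneg (hl0 k) hm0.le, fun x hx => ?_⟩
  -- The pair `(h x, obj x)` need not lie in `U`; shifting all coordinates by `δ` puts it there and
  -- changes `f` by exactly `ε`.
  have key : opt * m ≤ ∑ k, h k x * l k + obj x * m := by
    refine le_of_forall_pos_le_add fun ε hε => ?_
    have hs : 0 ≤ ∑ k, l k := Finset.sum_nonneg fun k _ => hl0 k
    set δ := ε / (∑ k, l k + m) with hδ
    have hδ0 : 0 < δ := div_pos hε (by linarith)
    have h1 := hf (fun k => h k x + δ, obj x + δ) ⟨x, hx, fun k => by simpa, by simpa⟩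
    rw [hfq, hfq] at h1
    simp only [Pi.zero_apply, zero_mul, Finset.sum_const_zero, zero_add, add_mul,
      Finset.sum_add_distrib] at h1
    rw [← Finset.mul_sum] at h1
    have h2 : δ * ∑ k, l k + δ * m = ε := by
      rw [← mul_add, hδ, div_mul_cancel₀]
      linarith
    linarith
  have e : obj x + ∑ k, l k / m * h k x = (∑ k, h k x * l k + obj x * m) / m := by
    rw [add_div, mul_div_cancel_right₀ _ hm0.ne', Finset.sum_div, add_comm]
    congr 1
    exact Finset.sum_congr rfl fun k _ => by ring
  rw [e, le_div_iff₀ hm0]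
  exact key

/-! ### Weak duality and complementary slackness -/

section Duality

variable {F C S : Type u} [Fintype F] [Fintype C] [Fintype S] {X : Type v} [PseudoMetricSpace X]
  {I : Problem F C S X}

theorem Problem.c_nonneg (I : Problem F C S X) (i : F) (j : C) : 0 ≤ I.c i j := dist_nonneg

/-- Weak duality, with the gap left by the constraints `w ≥ v - c` made explicit. -/
theorem Problem.budget_add_slack_le {s : Sol F C S} {d : DualSol F C S}
    (hs : I.PrimalFeasible s) (hd : I.DualFeasible d) :
    ∑ A, I.prob A * I.budget d A
      + ∑ A, I.prob A * ∑ j ∈ I.clients A, ∑ i, (I.c i j + d.w A i j - d.v A j) * s.x A i j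
      ≤ I.totalFac s + I.totalCon s := by
  have h1 : ∀ A, I.budget d A
      + ∑ j ∈ I.clients A, ∑ i, (I.c i j + d.w A i j - d.v A j) * s.x A i j
      ≤ ∑ j ∈ I.clients A, ∑ i, I.c i j * s.x A i j
        + ∑ i, (∑ j ∈ I.clients A, d.w A i j) * s.yI i
        + ∑ i, (∑ j ∈ I.clients A, d.w A i j) * s.yII A i := by
    intro A
    simp only [Problem.budget, Finset.sum_mul]
    rw [Finset.sum_comm (s := (Finset.univ : Finset F)),
      Finset.sum_comm (s := (Finset.univ : Finset F)),
      ← Finset.sum_add_distrib, ← Finset.sum_add_distrib, ← Finset.sum_add_distrib]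
    refine Finset.sum_le_sum fun j hj => ?_
    have h2 : d.v A j ≤ d.v A j * ∑ i, s.x A i j :=
      le_mul_of_one_le_right (hd.v_nonneg A j hj) (hs.covered A j hj)
    rw [Finset.mul_sum] at h2
    refine (add_le_add_left h2 _).trans ?_
    rw [← Finset.sum_add_distrib, ← Finset.sum_add_distrib, ← Finset.sum_add_distrib]
    refine Finset.sum_le_sum fun i _ => ?_
    -- Adding the slack cancels `v`: what remains is `c * x + w * x`, and `x ≤ yI + yII`.
    have := mul_le_mul_of_nonneg_left (hs.le_open A i j hj) (hd.w_nonneg A i j hj)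
    linarith
  have h2 := Finset.sum_le_sum fun A (_ : A ∈ Finset.univ) =>
    mul_le_mul_of_nonneg_left (h1 A) (I.prob_nonneg A)
  simp only [mul_add, Finset.sum_add_distrib] at h2
  refine h2.trans ?_
  have h3 : ∑ A, I.prob A * ∑ i, (∑ j ∈ I.clients A, d.w A i j) * s.yI i
      ≤ ∑ i, I.openI i * s.yI i := by
    simp only [Finset.mul_sum]
    rw [Finset.sum_comm]
    refine Finset.sum_le_sum fun i _ => ?_
    simp only [← mul_assoc]
    rw [← Finset.sum_mul]
    exact mul_le_mul_of_nonneg_right (hd.first_le i) (hs.yI_nonneg i)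
  have h4 : ∑ A, I.prob A * ∑ i, (∑ j ∈ I.clients A, d.w A i j) * s.yII A i
      ≤ ∑ A, I.prob A * ∑ i, I.openII A i * s.yII A i :=
    Finset.sum_le_sum fun A _ => mul_le_mul_of_nonneg_left
      (Finset.sum_le_sum fun i _ => mul_le_mul_of_nonneg_right (hd.second_le A i)
        (hs.yII_nonneg A i)) (I.prob_nonneg A)
  simp only [Problem.totalFac, Problem.totalCon]
  linarith

theorem Problem.budget_le {s : Sol F C S} {d : DualSol F C S}
    (hs : I.PrimalFeasible s) (hd : I.DualFeasible d) :
    ∑ A, I.prob A * I.budget d A ≤ I.totalFac s + I.totalCon s := by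
  refine le_trans (le_add_of_nonneg_right ?_) (I.budget_add_slack_le hs hd)
  exact Finset.sum_nonneg fun A _ => mul_nonneg (I.prob_nonneg A) <|
    Finset.sum_nonneg fun j hj => Finset.sum_nonneg fun i _ =>
      mul_nonneg (by linarith [hd.w_ge A i j hj]) (hs.x_nonneg A i j hj)

/-- Complementary slackness: a client is served by facilities within its dual budget. -/
theorem Problem.c_le_of_x_pos {s : Sol F C S} {d : DualSol F C S}
    (hs : I.PrimalFeasible s) (hd : I.DualFeasible d)
    (h : I.totalFac s + I.totalCon s ≤ ∑ A, I.prob A * I.budget d A)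
    {A : S} (hA : 0 < I.prob A) {i : F} {j : C} (hj : j ∈ I.clients A) (hx : 0 < s.x A i j) :
    I.c i j ≤ d.v A j := by
  -- With no duality gap the weighted slack sum is at most 0. Its terms are nonnegative, so none is
  -- positive; dividing by `prob A` and `x` leaves `c + w ≤ v`, and `w ≥ 0`.
  have h1 := I.budget_add_slack_le hs hd
  have n1 : ∀ A, ∀ j ∈ I.clients A, ∀ i, 0 ≤ (I.c i j + d.w A i j - d.v A j) * s.x A i j :=
    fun A j hj i => mul_nonneg (by linarith [hd.w_ge A i j hj]) (hs.x_nonneg A i j hj)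
  have n2 : ∀ A, 0 ≤ ∑ j ∈ I.clients A, ∑ i, (I.c i j + d.w A i j - d.v A j) * s.x A i j :=
    fun A => Finset.sum_nonneg fun j hj => Finset.sum_nonneg fun i _ => n1 A j hj i
  have h2 : I.prob A * ∑ j ∈ I.clients A, ∑ i, (I.c i j + d.w A i j - d.v A j) * s.x A i j ≤ 0 :=
    (Finset.single_le_sum (f := fun A => I.prob A * ∑ j ∈ I.clients A, ∑ i,
      (I.c i j + d.w A i j - d.v A j) * s.x A i j)
      (fun A _ => mul_nonneg (I.prob_nonneg A) (n2 A)) (Finset.mem_univ A)).trans (by linarith)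
  have h3 : (I.c i j + d.w A i j - d.v A j) * s.x A i j ≤ 0 :=
    ((Finset.single_le_sum (f := fun i => (I.c i j + d.w A i j - d.v A j) * s.x A i j)
      (fun i _ => n1 A j hj i) (Finset.mem_univ i)).trans
    (Finset.single_le_sum (f := fun j => ∑ i, (I.c i j + d.w A i j - d.v A j) * s.x A i j)
      (fun j hj => Finset.sum_nonneg fun i _ => n1 A j hj i) hj)).trans
      (nonpos_of_mul_nonpos_right h2 hA)
  have h4 := nonpos_of_mul_nonpos_left h3 hx
  linarith [hd.w_nonneg A i j hj]

theorem Problem.totalFac_nonneg {s : Sol F C S} (hs : I.PrimalFeasible s) : 0 ≤ I.totalFac s :=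
  add_nonneg (Finset.sum_nonneg fun i _ => mul_nonneg (I.openI_nonneg i) (hs.yI_nonneg i))
    (Finset.sum_nonneg fun A _ => mul_nonneg (I.prob_nonneg A) <| Finset.sum_nonneg fun i _ =>
      mul_nonneg (I.openII_nonneg A i) (hs.yII_nonneg A i))

theorem Problem.totalCon_nonneg {s : Sol F C S} (hs : I.PrimalFeasible s) : 0 ≤ I.totalCon s :=
  Finset.sum_nonneg fun A _ => mul_nonneg (I.prob_nonneg A) <| Finset.sum_nonneg fun j hj =>
    Finset.sum_nonneg fun i _ => mul_nonneg (I.c_nonneg i j) (hs.x_nonneg A i j hj)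

end Duality

/-! ### Strong duality -/

section StrongDuality

variable {F C S : Type u} [Fintype F] [Fintype C] [Fintype S] {X : Type v} [PseudoMetricSpace X]
  {I : Problem F C S X}

/-- An affine function bounded below on a ray has nonnegative slope. -/
theorem slope_nonneg_of_bounded_below {a b c : ℝ} (h : ∀ t : ℝ, 0 ≤ t → a ≤ b + t * c) :
    0 ≤ c := by
  by_contra! hc
  have h1 := h ((|b - a| + 1) / (-c)) (div_nonneg (by positivity) (by linarith))
  rw [div_mul_eq_mul_div, div_neg, mul_div_cancel_right₀ _ hc.ne] at h1
  linarith [le_abs_self (b - a)]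

/-- Inactive pairs carry the dummy constraint `-1 ≤ 0`, which never obstructs Slater's condition;
their multipliers only lower the Lagrangian and can be dropped. -/
theorem sum_mul_ite_neg_one_le [DecidableEq C] (K : Finset C) (a f : C → ℝ) (ha : ∀ j, 0 ≤ a j) :
    ∑ j, a j * (if j ∈ K then f j else -1) ≤ ∑ j ∈ K, a j * f j := by
  calc ∑ j, a j * (if j ∈ K then f j else -1) ≤ ∑ j, if j ∈ K then a j * f j else 0 := by
        refine Finset.sum_le_sum fun j _ => ?_
        split_ifs
        · exact le_rfl
        · linarith [ha j]
    _ = ∑ j ∈ K, a j * f j := by simp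

/-- Only the covering and opening constraints are priced; nonnegativity stays in the domain `Set.Ici
0`. Objective and constraints are affine, so convexity holds with equality. -/
theorem Problem.exists_multipliers [DecidableEq C] {s : Sol F C S} (hs : I.PrimalOptimal s) :
    ∃ (α : S → C → ℝ) (β : S → F → C → ℝ), (∀ A j, 0 ≤ α A j) ∧ (∀ A i j, 0 ≤ β A i j) ∧
      ∀ t : Sol F C S, (∀ i, 0 ≤ t.yI i) → (∀ A i, 0 ≤ t.yII A i) → (∀ A i j, 0 ≤ t.x A i j) →
        I.totalFac s + I.totalCon s ≤ I.totalFac t + I.totalCon t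
          + ∑ A, ∑ j ∈ I.clients A, α A j * (1 - ∑ i, t.x A i j)
          + ∑ A, ∑ i, ∑ j ∈ I.clients A, β A i j * (t.x A i j - t.yI i - t.yII A i) := by
  classical
  let sol : (F → ℝ) × (S → F → ℝ) × (S → F → C → ℝ) → Sol F C S := fun e => ⟨e.1, e.2.1, e.2.2⟩
  let h : (S × C) ⊕ (S × F × C) → (F → ℝ) × (S → F → ℝ) × (S → F → C → ℝ) → ℝ := fun k e =>
    Sum.elim (fun q => if q.2 ∈ I.clients q.1 then 1 - ∑ i, e.2.2 q.1 i q.2 else -1)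
      (fun q => if q.2.2 ∈ I.clients q.1 then
        e.2.2 q.1 q.2.1 q.2.2 - e.1 q.2.1 - e.2.1 q.1 q.2.1 else -1) k
  have hobj : ConvexOn ℝ (Set.Ici 0) fun e => I.totalFac (sol e) + I.totalCon (sol e) := by
    refine ⟨convex_Ici _, fun x _ y _ a b _ _ _ => le_of_eq ?_⟩
    simp only [Problem.totalFac, Problem.totalCon, sol, Prod.fst_add, Prod.snd_add, Prod.smul_fst,
      Prod.smul_snd, Pi.add_apply, Pi.smul_apply, smul_eq_mul, mul_add, Finset.sum_add_distrib,
      Finset.mul_sum, mul_left_comm a, mul_left_comm b]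
    ring
  have hh : ∀ k, ConvexOn ℝ (Set.Ici 0) (h k) := by
    rintro (q | q) <;> refine ⟨convex_Ici _, fun x _ y _ a b _ _ hab => le_of_eq ?_⟩
    · simp only [h, Sum.elim_inl]
      split_ifs
      · simp only [Prod.snd_add, Prod.smul_snd, Pi.add_apply, Pi.smul_apply, smul_eq_mul, 
          Finset.sum_add_distrib, ← Finset.mul_sum]
        linear_combination -hab
      · simp only [smul_eq_mul]
        linear_combination hab
    · simp only [h, Sum.elim_inr]
      split_ifs
      · simp only [Prod.fst_add, Prod.snd_add, Prod.smul_fst, Prod.smul_snd, Pi.add_apply,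
          Pi.smul_apply, smul_eq_mul]
        ring
      · simp only [smul_eq_mul]
        linear_combination hab
  obtain ⟨l, hl, hl'⟩ := exists_lagrange_multipliers _ hobj h hh (I.totalFac s + I.totalCon s)
    -- Slater point: `x = 2 < 3 = yI + yII`, and coverage is `2 * card F > 1` because a covered
    -- client forces `F` to be nonempty.
    ⟨(fun _ => 3, 0, fun _ _ _ => 2), by
      refine ⟨fun _ => ?_, le_rfl, fun _ _ _ => ?_⟩ <;> norm_num, by
      rintro (⟨A, j⟩ | ⟨A, i, j⟩)
      · simp only [h, Sum.elim_inl]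
        split_ifs with hj
        · have h1 := hs.1.covered A j hj
          have h2 : 1 ≤ Fintype.card F := by
            by_contra! h3
            have : IsEmpty F := Fintype.card_eq_zero_iff.1 (by omega)
            simp at h1
            linarith
          have h3 : (1 : ℝ) ≤ Fintype.card F := by exact_mod_cast h2
          simp
          linarith
        · norm_num
      · simp only [h, Sum.elim_inr]
        split_ifs <;> norm_num⟩
    (by
      intro e he hk
      refine hs.2 _ ⟨fun A j hj => ?_, fun A i j hj => ?_, fun A i j _ => he.2.2 A i j,
        he.1, he.2.1⟩
      · have := hk (Sum.inl (A, j))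
        simp only [h, Sum.elim_inl, if_pos hj] at this
        simp only [sol]
        linarith
      · have := hk (Sum.inr (A, i, j))
        simp only [h, Sum.elim_inr, if_pos hj] at this
        simp only [sol]
        linarith)
  refine ⟨fun A j => l (Sum.inl (A, j)), fun A i j => l (Sum.inr (A, i, j)), fun _ _ => hl _,
    fun _ _ _ => hl _, fun t h1 h2 h3 => ?_⟩
  have key := hl' (t.yI, t.yII, t.x) ⟨h1, h2, h3⟩
  rw [Fintype.sum_sum_type, Fintype.sum_prod_type, Fintype.sum_prod_type] at key
  simp only [Fintype.sum_prod_type, h, Sum.elim_inl, Sum.elim_inr, ← add_assoc, sol] at key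
  refine key.trans (add_le_add (add_le_add le_rfl ?_) ?_)
  · exact Finset.sum_le_sum fun A _ => sum_mul_ite_neg_one_le _ _ _ fun _ => hl _
  · exact Finset.sum_le_sum fun A _ => Finset.sum_le_sum fun i _ =>
      (sum_mul_ite_neg_one_le _ _ _ fun _ => hl _)

/-- The Lagrangian is affine and bounded below on the nonnegative orthant, so the coefficient of
each variable is nonnegative. These coefficients are the dual constraints scaled by `p_A`, and the
origin gives the objective value. -/
theorem Problem.exists_dual_ge {s : Sol F C S} (hs : I.PrimalOptimal s) :
    ∃ d, I.DualFeasible d ∧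
      I.totalFac s + I.totalCon s ≤ ∑ A, I.prob A * I.budget d A := by
  classical
  obtain ⟨α, β, hα, hβ, h⟩ := I.exists_multipliers hs
  have hzero : I.totalFac s + I.totalCon s ≤ ∑ A, ∑ j ∈ I.clients A, α A j := by
    simpa [Problem.totalFac, Problem.totalCon] using
      h ⟨0, 0, 0⟩ (fun _ => le_rfl) (fun _ _ => le_rfl) (fun _ _ _ => le_rfl)
  have hI : ∀ i, ∑ A, ∑ j ∈ I.clients A, β A i j ≤ I.openI i := by
    intro i
    rw [← sub_nonneg]
    refine slope_nonneg_of_bounded_below (a := I.totalFac s + I.totalCon s)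
      (b := ∑ A, ∑ j ∈ I.clients A, α A j) fun t ht => ?_
    refine (h ⟨Pi.single i t, 0, 0⟩ (fun i' => ?_) (fun _ _ => le_rfl)
      (fun _ _ _ => le_rfl)).trans (le_of_eq ?_)
    · by_cases hi : i' = i
      · subst hi; simpa
      · simp [hi]
    · simp [Problem.totalFac, Problem.totalCon, Pi.single_apply, ← Finset.sum_mul]
      ring
  have hII : ∀ A i, ∑ j ∈ I.clients A, β A i j ≤ I.prob A * I.openII A i := by
    intro A i
    rw [← sub_nonneg]
    refine slope_nonneg_of_bounded_below (a := I.totalFac s + I.totalCon s)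
      (b := ∑ A, ∑ j ∈ I.clients A, α A j) fun t ht => ?_
    refine (h ⟨0, fun A' i' => if A' = A then (if i' = i then t else 0) else 0, 0⟩
      (fun _ => le_rfl) (fun A' i' => ?_)
      (fun _ _ _ => le_rfl)).trans (le_of_eq ?_)
    · dsimp only
      split_ifs <;> first | exact ht | exact le_rfl
    · simp [Problem.totalFac, Problem.totalCon, mul_sub, Finset.sum_ite_irrel, ← Finset.sum_mul]
      ring
  have hx : ∀ A i, ∀ j ∈ I.clients A, α A j - β A i j ≤ I.prob A * I.c i j := by
    intro A i j hj
    rw [← sub_nonneg]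
    refine slope_nonneg_of_bounded_below (a := I.totalFac s + I.totalCon s)
      (b := ∑ A, ∑ j ∈ I.clients A, α A j) fun t ht => ?_
    refine (h ⟨0, 0, fun A' i' j' => if A' = A then (if i' = i then (if j' = j then t else 0)
      else 0) else 0⟩ (fun _ => le_rfl)
      (fun _ _ => le_rfl) (fun A' i' j' => ?_)).trans (le_of_eq ?_)
    · dsimp only
      split_ifs <;> first | exact ht | exact le_rfl
    · simp [Problem.totalFac, Problem.totalCon, mul_sub, Finset.sum_ite_irrel, hj, Finset.sum_sub_distrib]
      ring
  -- Undo the scaling by `p_A`. If `p_A = 0`, division by zero makes `v` and `w` vanish in that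
  -- scenario.
  refine ⟨⟨fun A j => α A j / I.prob A, fun A i j => β A i j / I.prob A⟩,
    ⟨fun A i j hj => ?_, fun i => ?_, fun A i => ?_, fun A i j _ => div_nonneg (hβ A i j)
      (I.prob_nonneg A), fun A j _ => div_nonneg (hα A j) (I.prob_nonneg A)⟩, ?_⟩
  · rcases (I.prob_nonneg A).eq_or_lt with hA | hA
    · simpa [← hA] using I.c_nonneg i j
    · have := hx A i j hj
      dsimp only
      rw [sub_le_iff_le_add, div_le_iff₀ hA, add_mul, div_mul_cancel₀ _ hA.ne']
      linarith
  · refine (Finset.sum_le_sum fun A _ => ?_).trans (hI i)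
    rcases (I.prob_nonneg A).eq_or_lt with hA | hA
    · simpa [← hA] using Finset.sum_nonneg fun j _ => hβ A i j
    · rw [← Finset.sum_div, mul_div_cancel₀ _ hA.ne']
  · rcases (I.prob_nonneg A).eq_or_lt with hA | hA
    · simpa [← hA] using I.openII_nonneg A i
    · rw [← Finset.sum_div, div_le_iff₀ hA, mul_comm]
      exact hII A i
  · refine hzero.trans (Finset.sum_le_sum fun A _ => ?_)
    simp only [Problem.budget]
    rcases (I.prob_nonneg A).eq_or_lt with hA | hA
    -- The budget discards the multipliers of a null scenario, so they must not be positive: `hx`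
    -- and `hII` give `α ≤ β` and `∑ β ≤ 0`.
    · rw [← hA, zero_mul]
      refine Finset.sum_nonpos fun j hj => ?_
      have hF : Nonempty F := by
        by_contra hF
        rw [not_nonempty_iff] at hF
        have := hs.1.covered A j hj
        simp at this
        linarith
      obtain ⟨i⟩ := hF
      have h1 := hx A i j hj
      have h2 := hII A i
      have h3 := Finset.single_le_sum (fun j _ => hβ A i j) hj
      rw [← hA, zero_mul] at h1 h2
      linarith
    · rw [← Finset.sum_div, mul_div_cancel₀ _ hA.ne']

/-- Strong duality, for an arbitrary optimal dual solution. -/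
theorem Problem.le_budget_of_dualOptimal {s : Sol F C S} {d : DualSol F C S}
    (hs : I.PrimalOptimal s) (hd : I.DualOptimal d) :
    I.totalFac s + I.totalCon s ≤ ∑ A, I.prob A * I.budget d A := by
  obtain ⟨e, he, h⟩ := I.exists_dual_ge hs
  exact h.trans (hd.2 e he)

end StrongDuality

/-! ### Independent draws of one stage -/

section Draws

variable {G P : Type u} [Fintype G] [DecidableEq G] (m : G → ℝ) (cand : P → Finset G)
  (centers : Finset P)

theorem drawProb_eq_zero (ω : Draws G centers) (p : {p // p ∈ centers}) (h : ω.1 p ∉ cand p) :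
    drawProb m cand centers ω = 0 := by
  unfold drawProb
  rw [Finset.prod_eq_zero (Finset.mem_univ p) (by simp [h]), zero_mul]

variable [DecidableEq P]

/-- Expectation of a product of functions of the individual draws. -/
theorem sum_drawProb_mul_prod (a : {p // p ∈ centers} → G → ℝ)
    (b : G → Bool → ℝ) :
    ∑ ω : Draws G centers, drawProb m cand centers ω * ((∏ p, a p (ω.1 p)) * ∏ g, b g (ω.2 g))
      = (∏ p : {p // p ∈ centers}, ∑ g ∈ cand p, m g * a p g)
        * ∏ g, (m g * b g true + (1 - m g) * b g false) := by
  have e1 := Finset.prod_univ_sum (fun _ : {p // p ∈ centers} => (Finset.univ : Finset G))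
    (fun p g => (if g ∈ cand p then m g else (0 : ℝ)) * a p g)
  have e2 := Finset.prod_univ_sum (fun _ : G => (Finset.univ : Finset Bool))
    (fun g c => (if c = true then m g else 1 - m g) * b g c)
  rw [Fintype.piFinset_univ] at e1 e2
  have e3 : ∀ p : {p // p ∈ centers}, ∑ g ∈ cand p, m g * a p g
      = ∑ g, (if g ∈ cand p then m g else (0 : ℝ)) * a p g := by
    intro p
    simp [ite_mul]
  have e4 : ∀ g, m g * b g true + (1 - m g) * b g false
      = ∑ c : Bool, (if c = true then m g else 1 - m g) * b g c := by
    intro g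
    simp
  rw [Finset.prod_congr rfl fun p _ => e3 p, Finset.prod_congr rfl fun g _ => e4 g, e1, e2,
    Fintype.sum_mul_sum, Fintype.sum_prod_type]
  refine Finset.sum_congr rfl fun x _ => Finset.sum_congr rfl fun y _ => ?_
  simp only [drawProb, Finset.prod_mul_distrib]
  ring

variable {m cand centers}

/-- A set of copies is completely closed with probability at most `exp (-m B)`. -/
theorem prob_disjoint_opened_le (h0 : ∀ g, 0 ≤ m g) (h1 : ∀ g, m g ≤ 1)
    (h : ∀ p ∈ centers, ∑ g ∈ cand p, m g = 1) (B : Finset G) :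
    ∑ ω : Draws G centers,
      drawProb m cand centers ω * (if Disjoint (opened cand centers ω) B then 1 else 0)
      ≤ Real.exp (-∑ g ∈ B, m g) := by
  classical
  -- Indicators that a single draw avoids `B`; coins of clustered copies never count. Their product
  -- is 1 whenever no copy of `B` is opened.
  let a : {p // p ∈ centers} → G → ℝ := fun _ g => if g ∈ B then 0 else 1
  let b : G → Bool → ℝ := fun g c =>
    if g ∈ B ∧ (∀ p ∈ centers, g ∉ cand p) ∧ c = true then 0 else 1
  have ha : ∀ p g, 0 ≤ a p g := fun p g => by simp only [a]; split_ifs <;> norm_num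
  have hb : ∀ g c, 0 ≤ b g c := fun p g => by simp only [b]; split_ifs <;> norm_num
  calc _ ≤ ∑ ω : Draws G centers,
        drawProb m cand centers ω * ((∏ p, a p (ω.1 p)) * ∏ g, b g (ω.2 g)) := by
        refine Finset.sum_le_sum fun ω _ =>
          mul_le_mul_of_nonneg_left ?_ (drawProb_nonneg _ _ _ h0 h1 ω)
        split_ifs with hd
        · rw [Finset.disjoint_left] at hd
          rw [Finset.prod_eq_one, Finset.prod_eq_one, one_mul]
          · intro g _
            refine if_neg ?_
            rintro ⟨hg, hu, hc⟩
            exact hd (Finset.mem_filter.2 ⟨Finset.mem_univ _, Or.inr ⟨hu, hc⟩⟩) hg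
          · intro p _
            refine if_neg ?_
            intro hg
            exact hd (Finset.mem_filter.2 ⟨Finset.mem_univ _, Or.inl ⟨p, rfl⟩⟩) hg
        · exact mul_nonneg (Finset.prod_nonneg fun p _ => ha p _)
            (Finset.prod_nonneg fun g _ => hb g _)
    _ = (∏ p : {p // p ∈ centers}, ∑ g ∈ cand p, m g * a p g)
        * ∏ g, (m g * b g true + (1 - m g) * b g false) := sum_drawProb_mul_prod m cand centers a b
    _ ≤ (∏ p : {p // p ∈ centers}, Real.exp (-∑ g ∈ cand p, if g ∈ B then m g else 0))
        * ∏ g, Real.exp (-(if g ∈ B ∧ (∀ p ∈ centers, g ∉ cand p) then m g else 0)) := by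
        refine mul_le_mul (Finset.prod_le_prod (fun p _ => ?_) fun p _ => ?_)
          (Finset.prod_le_prod (fun g _ => ?_) fun g _ => ?_)
          (Finset.prod_nonneg fun g _ => ?_) (Finset.prod_nonneg fun p _ => (Real.exp_pos _).le)
        · exact Finset.sum_nonneg fun g _ => mul_nonneg (h0 g) (ha p g)
        · have e : ∑ g ∈ cand p, m g * a p g
              = 1 - ∑ g ∈ cand p, if g ∈ B then m g else 0 := by
            rw [← h p p.2, ← Finset.sum_sub_distrib]
            refine Finset.sum_congr rfl fun g _ => ?_
            simp only [a]
            split_ifs <;> simp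
          rw [e]
          linarith [Real.add_one_le_exp (-∑ g ∈ cand p, if g ∈ B then m g else 0)]
        · exact add_nonneg (mul_nonneg (h0 g) (hb _ _))
            (mul_nonneg (sub_nonneg.2 (h1 g)) (hb _ _))
        · by_cases hg : g ∈ B ∧ ∀ p ∈ centers, g ∉ cand p
          · have ht : b g true = 0 := if_pos ⟨hg.1, hg.2, rfl⟩
            have hf : b g false = 1 := if_neg (by simp)
            rw [if_pos hg, ht, hf]
            linarith [Real.add_one_le_exp (-m g)]
          · have : ∀ c, b g c = 1 := fun c => if_neg fun hc => hg ⟨hc.1, hc.2.1⟩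
            simp [this, hg]
        · exact add_nonneg (mul_nonneg (h0 g) (hb _ _))
            (mul_nonneg (sub_nonneg.2 (h1 g)) (hb _ _))
    _ ≤ Real.exp (-∑ g ∈ B, m g) := by
        -- Every member of `B` contributes to the exponent at least once: as an unclustered copy or
        -- through a cluster containing it.
        rw [← Real.exp_sum, ← Real.exp_sum, ← Real.exp_add, Real.exp_le_exp,
          Finset.sum_neg_distrib, Finset.sum_neg_distrib, ← neg_add, neg_le_neg_iff]
        have e : ∀ p : {p // p ∈ centers}, (∑ g ∈ cand p, if g ∈ B then m g else 0)
            = ∑ g, if g ∈ B ∧ g ∈ cand p then m g else 0 := by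
          intro p
          rw [← Finset.sum_filter, ← Finset.sum_filter]
          congr 1
          ext g
          simp [and_comm]
        rw [Finset.sum_congr rfl fun p _ => e p, Finset.sum_comm, ← Finset.sum_add_distrib,
          ← Finset.sum_filter_add_sum_filter_not Finset.univ (· ∈ B)]
        rw [← add_zero (∑ g ∈ B, m g)]
        have hn : ∀ g, 0 ≤ ∑ p : {p // p ∈ centers}, if g ∈ B ∧ g ∈ cand p then m g else 0 :=
          fun g => Finset.sum_nonneg fun p _ => by split_ifs; exacts [h0 g, le_rfl]
        have hn' : ∀ g, 0 ≤ if g ∈ B ∧ (∀ p ∈ centers, g ∉ cand p) then m g else 0 :=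
          fun g => by split_ifs; exacts [h0 g, le_rfl]
        refine add_le_add ?_ (Finset.sum_nonneg fun g _ => add_nonneg (hn g) (hn' g))
        rw [Finset.filter_mem_eq_inter, Finset.univ_inter]
        refine Finset.sum_le_sum fun g hg => ?_
        by_cases hu : ∀ p ∈ centers, g ∉ cand p
        · rw [if_pos ⟨hg, hu⟩]
          linarith [hn g]
        · push Not at hu
          obtain ⟨p, hp, hgp⟩ := hu
          have := Finset.single_le_sum (f := fun p : {p // p ∈ centers} =>
            if g ∈ B ∧ g ∈ cand p then m g else 0)
            (fun p _ => by split_ifs; exacts [h0 g, le_rfl]) (Finset.mem_univ ⟨p, hp⟩)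
          simp only [hg, hgp, and_self, if_true] at this
          have := hn' g
          simp only [hg, true_and] at *
          linarith

/-- With disjoint clusters, a copy is opened with probability at most its fractional opening. -/
theorem prob_mem_opened_le (h0 : ∀ g, 0 ≤ m g) (h1 : ∀ g, m g ≤ 1)
    (h : ∀ p ∈ centers, ∑ g ∈ cand p, m g = 1)
    (hd : ∀ p ∈ centers, ∀ q ∈ centers, p ≠ q → Disjoint (cand p) (cand q)) (g₀ : G) :
    ∑ ω : Draws G centers,
      drawProb m cand centers ω * (if g₀ ∈ opened cand centers ω then 1 else 0) ≤ m g₀ := by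
  classical
  have nn := drawProb_nonneg m cand centers h0 h1
  by_cases hu : ∀ p ∈ centers, g₀ ∉ cand p
  -- An unclustered copy opens only through its coin, since a cluster drawing outside its own set
  -- has probability 0.
  · let b : G → Bool → ℝ := fun g c => if g = g₀ then (if c = true then 1 else 0) else 1
    have key := sum_drawProb_mul_prod m cand centers (fun _ _ => 1) b
    have e : (∏ p : {p // p ∈ centers}, ∑ g ∈ cand p, m g * 1) = 1 :=
      Finset.prod_eq_one fun p _ => by simpa using h p p.2
    rw [e, one_mul, Finset.prod_eq_single g₀ (fun g _ hg => by simp [b, hg]) (by simp)] at key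
    simp only [b, if_true, mul_one, Finset.prod_const_one, one_mul] at key
    simp only [Bool.false_eq_true, if_false, mul_zero, add_zero, Finset.prod_ite_eq',
      Finset.mem_univ, if_true] at key
    rw [← key]
    refine Finset.sum_le_sum fun ω _ => ?_
    by_cases hc : ω.2 g₀ = true
    · simp only [hc, if_true]
      exact mul_le_mul_of_nonneg_left (by split_ifs <;> norm_num) (nn ω)
    · split_ifs with ho
      · simp only [opened, Finset.mem_filter, Finset.mem_univ, true_and, hc, and_false,
          or_false, Bool.false_eq_true] at ho
        obtain ⟨p, hp⟩ := ho
        rw [drawProb_eq_zero m cand centers ω p (by rw [hp]; exact hu p p.2), zero_mul, zero_mul]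
      · rw [mul_zero]
  · push Not at hu
    -- A clustered copy opens only if its own cluster draws it: its coin is ignored, and
    -- disjointness makes a draw by another cluster a null event.
    obtain ⟨p₀, hp₀, hg₀⟩ := hu
    let a : {p // p ∈ centers} → G → ℝ := fun p g =>
      if p.1 = p₀ then (if g = g₀ then 1 else 0) else 1
    have key := sum_drawProb_mul_prod m cand centers a (fun _ _ => 1)
    have e : (∏ g, (m g * 1 + (1 - m g) * 1)) = 1 := Finset.prod_eq_one fun g _ => by ring
    have e' : (∏ p : {p // p ∈ centers}, ∑ g ∈ cand p, m g * a p g)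
        = ∑ g ∈ cand p₀, m g * (if g = g₀ then 1 else 0) := by
      rw [Finset.prod_eq_single (⟨p₀, hp₀⟩ : {p // p ∈ centers}) (fun p _ hp => ?_) (by simp)]
      · simp only [a, if_true]
      · have hp' : p.1 ≠ p₀ := fun h => hp (Subtype.ext h)
        simp only [a, hp', if_false, mul_one]
        exact h p p.2
    rw [e, mul_one, e'] at key
    simp only [a, Finset.prod_const_one, mul_one] at key
    simp only [mul_ite, mul_one, mul_zero, Finset.sum_ite_eq', hg₀, if_true] at key
    rw [← key]
    refine Finset.sum_le_sum fun ω _ => ?_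
    rw [Finset.prod_eq_single (⟨p₀, hp₀⟩ : {p // p ∈ centers}) (fun p _ hp => if_neg fun h => hp (Subtype.ext h))
      (by simp)]
    simp only [if_true]
    by_cases hc : ω.1 ⟨p₀, hp₀⟩ = g₀
    · simp only [hc, if_true]
      split_ifs <;> simp [nn ω]
    · split_ifs with ho
      · simp only [opened, Finset.mem_filter, Finset.mem_univ, true_and] at ho
        rcases ho with ⟨p, hp⟩ | ho
        · have hne : p.1 ≠ p₀ := by
            rintro rfl
            exact hc hp
          rw [drawProb_eq_zero m cand centers ω p
            (by rw [hp]; exact Finset.disjoint_right.1 (hd p p.2 p₀ hp₀ hne) hg₀)]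
          simp
        · exact absurd hg₀ (ho.1 p₀ hp₀)
      · exact le_rfl

/-- Bound on the expected cost of the facilities opened in one stage. -/
theorem expected_open_le {F : Type*} [DecidableEq F]
    (h0 : ∀ g, 0 ≤ m g) (h1 : ∀ g, m g ≤ 1)
    (h : ∀ p ∈ centers, ∑ g ∈ cand p, m g = 1)
    (hd : ∀ p ∈ centers, ∀ q ∈ centers, p ≠ q → Disjoint (cand p) (cand q))
    (proj : G → F) {f : F → ℝ} (hf : ∀ i, 0 ≤ f i) :
    ∑ ω : Draws G centers, drawProb m cand centers ω *
        ∑ i ∈ (opened cand centers ω).image proj, f i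
      ≤ ∑ g, f (proj g) * m g := by
  calc _ ≤ ∑ ω : Draws G centers, ∑ g, f (proj g) *
        (drawProb m cand centers ω * (if g ∈ opened cand centers ω then 1 else 0)) := by
        refine Finset.sum_le_sum fun ω _ => ?_
        have e : ∑ g, f (proj g) *
            (drawProb m cand centers ω * (if g ∈ opened cand centers ω then 1 else 0))
            = drawProb m cand centers ω * ∑ g ∈ opened cand centers ω, f (proj g) := by
          rw [Finset.mul_sum, ← Finset.sum_subset (Finset.subset_univ (opened cand centers ω))]
          · exact Finset.sum_congr rfl fun g hg => by rw [if_pos hg]; ring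
          · intro g _ hg
            rw [if_neg hg]
            ring
        rw [e]
        refine mul_le_mul_of_nonneg_left ?_ (drawProb_nonneg _ _ _ h0 h1 ω)
        -- A facility with several open copies is paid for once, so charging every copy only adds
        -- cost.
        exact Finset.sum_image_le_of_nonneg fun i _ => hf i
    _ ≤ _ := by
        rw [Finset.sum_comm]
        refine Finset.sum_le_sum fun g _ => ?_
        rw [← Finset.mul_sum]
        exact mul_le_mul_of_nonneg_left (prob_mem_opened_le h0 h1 h hd g) (hf _)

end Draws

/-! ### From tails to truncated means -/

section Tail

open MeasureTheory

theorem intervalIntegrable_ite_lt (a D : ℝ) :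
    IntervalIntegrable (fun r : ℝ => if r < a then (1 : ℝ) else 0) volume 0 D := by
  refine AntitoneOn.intervalIntegrable fun r _ r' _ hr => ?_
  split_ifs <;> linarith

theorem integral_ite_lt {a D : ℝ} (ha : 0 ≤ a) (hD : 0 ≤ D) :
    ∫ r in (0 : ℝ)..D, (if r < a then (1 : ℝ) else 0) = min a D := by
  have e : (fun r : ℝ => if r < a then (1 : ℝ) else 0) = (Set.Iio a).indicator 1 := by
    ext r
    simp [Set.indicator_apply]
  rw [e, intervalIntegral.integral_of_le hD, integral_indicator_one measurableSet_Iio,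
    measureReal_restrict_apply measurableSet_Iio]
  rcases le_or_gt a D with h | h
  · have : Set.Iio a ∩ Set.Ioc 0 D = Set.Ioo 0 a := by
      ext r
      simp only [Set.mem_inter_iff, Set.mem_Iio, Set.mem_Ioc, Set.mem_Ioo]
      exact ⟨fun h' => ⟨h'.2.1, h'.1⟩, fun h' => ⟨h'.2, h'.1, h'.2.le.trans h⟩⟩
    rw [this, min_eq_left h]
    simp [ha]
  · have : Set.Iio a ∩ Set.Ioc 0 D = Set.Ioc 0 D := by
      ext r
      simp only [Set.mem_inter_iff, Set.mem_Iio, Set.mem_Ioc]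
      exact ⟨fun h' => h'.2, fun h' => ⟨h'.2.trans_lt h, h'⟩⟩
    rw [this, min_eq_right h.le]
    simp [hD]

/-- Comparison of tails implies comparison of truncated means. -/
theorem sum_min_le_of_tail_le {Ω G : Type*} [Fintype Ω] [Fintype G] (P a : Ω → ℝ) (q c : G → ℝ)
    {K D : ℝ} (hD : 0 ≤ D) (ha : ∀ ω, 0 ≤ a ω) (hc : ∀ g, 0 ≤ c g)
    (h : ∀ r, ∑ ω, P ω * (if r < a ω then 1 else 0)
      ≤ K + ∑ g, q g * (if r < c g then 1 else 0)) :
    ∑ ω, P ω * min (a ω) D ≤ K * D + ∑ g, q g * min (c g) D := by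
  have i1 : IntervalIntegrable (fun r => ∑ ω, P ω * (if r < a ω then 1 else 0)) volume 0 D := by
    simpa only [Finset.sum_fn] using IntervalIntegrable.sum Finset.univ fun ω _ =>
      (intervalIntegrable_ite_lt (a ω) D).const_mul (P ω)
  have i2 : IntervalIntegrable (fun r => ∑ g, q g * (if r < c g then 1 else 0)) volume 0 D := by
    simpa only [Finset.sum_fn] using IntervalIntegrable.sum Finset.univ fun g _ =>
      (intervalIntegrable_ite_lt (c g) D).const_mul (q g)
  -- Layer-cake formula: the indicator of `r < a` integrates over `0..D` to `min a D`.
  have key := intervalIntegral.integral_mono hD i1 (intervalIntegrable_const.add i2) h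
  rw [intervalIntegral.integral_add intervalIntegrable_const i2,
    intervalIntegral.integral_finsetSum
      fun ω _ => (intervalIntegrable_ite_lt (a ω) D).const_mul _,
    intervalIntegral.integral_finsetSum
      fun g _ => (intervalIntegrable_ite_lt (c g) D).const_mul _] at key
  simp only [intervalIntegral.integral_const_mul, integral_ite_lt (ha _) hD,
    integral_ite_lt (hc _) hD, intervalIntegral.integral_const, smul_eq_mul, sub_zero] at key
  linarith

end Tail

/-! ### Greedy clustering -/

section Greedy

theorem draw_mem_opened {G P : Type u} [Fintype G] [DecidableEq G] {cand : P → Finset G}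
    {centers : Finset P} (ω : Draws G centers) (p : {p // p ∈ centers}) :
    ω.1 p ∈ opened cand centers ω :=
  Finset.mem_filter.2 ⟨Finset.mem_univ _, Or.inl ⟨p, rfl⟩⟩

variable {G P : Type u} [DecidableEq G] {cand : P → Finset G}

theorem greedyList_append_singleton (l : List P) (p : P) :
    greedyList cand (l ++ [p]) =
      if ∀ q ∈ greedyList cand l, Disjoint (cand p) (cand q) then greedyList cand l ++ [p]
      else greedyList cand l := by
  rw [greedyList, List.foldl_append]
  rfl

theorem mem_of_mem_greedyList {l : List P} : ∀ {q : P}, q ∈ greedyList cand l → q ∈ l := by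
  induction l using List.reverseRecOn with
  | nil => simp [greedyList]
  | append_singleton l p ih =>
    intro q hq
    rw [greedyList_append_singleton] at hq
    split_ifs at hq
    · rw [List.mem_append] at hq ⊢
      exact hq.imp_left ih
    · exact List.mem_append_left _ (ih hq)

theorem disjoint_of_mem_greedyList {l : List P} :
    ∀ {p q : P}, p ∈ greedyList cand l → q ∈ greedyList cand l → p ≠ q →
      Disjoint (cand p) (cand q) := by
  induction l using List.reverseRecOn with
  | nil => simp [greedyList]
  | append_singleton l r ih =>
    intro p q hp hq hpq
    rw [greedyList_append_singleton] at hp hq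
    split_ifs at hp hq with h
    · rw [List.mem_append, List.mem_singleton] at hp hq
      rcases hp with hp | rfl <;> rcases hq with hq | rfl
      · exact ih hp hq hpq
      · exact (h p hp).symm
      · exact h q hq
      · exact absurd rfl hpq
    · exact ih hp hq hpq

/-- Every nonempty candidate meets a cluster that comes no later in the order. -/
theorem exists_greedyList_not_disjoint {l : List P} {ρ : P → ℝ}
    (hl : l.Pairwise fun p q => ρ p ≤ ρ q) :
    ∀ p ∈ l, (cand p).Nonempty →
      ∃ q ∈ greedyList cand l, ρ q ≤ ρ p ∧ ¬ Disjoint (cand p) (cand q) := by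
  induction l using List.reverseRecOn with
  | nil => simp
  | append_singleton l r ih =>
    intro p hp hne
    rw [List.pairwise_append] at hl
    rw [greedyList_append_singleton]
    rw [List.mem_append, List.mem_singleton] at hp
    rcases hp with hp | rfl
    · obtain ⟨q, hq, hqp, hd⟩ := ih hl.1 p hp hne
      refine ⟨q, ?_, hqp, hd⟩
      split_ifs
      · exact List.mem_append_left _ hq
      · exact hq
    -- Either the last candidate becomes a cluster and meets itself, being nonempty, or the cluster
    -- blocking it precedes it in the sorted list.
    · split_ifs with h
      · exact ⟨p, by simp, le_rfl, by simpa [disjoint_self] using hne.ne_empty⟩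
      · push Not at h
        obtain ⟨q, hq, hd⟩ := h
        exact ⟨q, hq, hl.2.2 q (mem_of_mem_greedyList hq) p (by simp), hd⟩

end Greedy

/-! ### Fallback distance through a cluster -/

section Fallback

variable {F C S : Type u} [Fintype F] [Fintype C] [Fintype S] {X : Type v} [PseudoMetricSpace X]
  {I : Problem F C S X} {G : Type u} {proj : G → F}

theorem Problem.c_le_radius {K : Finset G} {g : G} (hg : g ∈ K) (j : C) :
    I.c (proj g) j ≤ I.radius proj K j := by
  rw [Problem.radius, dif_pos ⟨g, hg⟩]
  exact Finset.le_sup' (fun g => I.c (proj g) j) hg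

theorem Problem.radius_le {K : Finset G} (hK : K.Nonempty) {j : C} {r : ℝ}
    (h : ∀ g ∈ K, I.c (proj g) j ≤ r) : I.radius proj K j ≤ r := by
  rw [Problem.radius, dif_pos hK]
  exact Finset.sup'_le _ _ h

theorem Problem.c_le_add (I : Problem F C S X) (i i' : F) (j j' : C) :
    I.c i j ≤ I.c i j' + I.c i' j' + I.c i' j := by
  have h1 := dist_triangle (I.facLoc i) (I.cliLoc j') (I.cliLoc j)
  have h2 := dist_triangle (I.cliLoc j') (I.facLoc i') (I.cliLoc j)
  rw [dist_comm (I.cliLoc j') (I.facLoc i')] at h2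
  simp only [Problem.c]
  linarith

theorem Problem.nearest_le {O : Finset F} {i : F} (hi : i ∈ O) (j : C) :
    I.nearest O j ≤ I.c i j := by
  rw [Problem.nearest, dif_pos ⟨i, hi⟩]
  exact Finset.inf'_le (fun i => I.c i j) hi

theorem Problem.nearest_nonneg (I : Problem F C S X) (O : Finset F) (j : C) :
    0 ≤ I.nearest O j := by
  rw [Problem.nearest]
  split_ifs with h
  · exact Finset.le_inf' _ _ fun i _ => I.c_nonneg i j
  · exact le_rfl

variable [Fintype G] [DecidableEq G] [DecidableEq C] [DecidableEq S]

/-- In a stage where client `j` is served within radius `r`, some copy within distance `3 * r` of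
`j` is opened: the one drawn by a cluster that meets the candidate set of `j`. -/
theorem Problem.exists_opened_c_le {cand : S × C → Finset G} {l : List (S × C)}
    (hl : l.Pairwise fun q r => I.radius proj (cand q) q.2 ≤ I.radius proj (cand r) r.2)
    {m : G → ℝ} {ω : Draws G (greedyCenters cand l)}
    (hω : drawProb m cand (greedyCenters cand l) ω ≠ 0) {q : S × C} (hq : q ∈ l)
    (hne : (cand q).Nonempty) {r : ℝ} (hr : ∀ g ∈ cand q, I.c (proj g) q.2 ≤ r) :
    ∃ g ∈ opened cand (greedyCenters cand l) ω, I.c (proj g) q.2 ≤ 3 * r := by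
  obtain ⟨q', hq', hle, hd⟩ := exists_greedyList_not_disjoint hl q hq hne
  let p : {p // p ∈ greedyCenters cand l} := ⟨q', List.mem_toFinset.2 hq'⟩
  have hp : ω.1 p ∈ cand q' := by
    by_contra h
    exact hω (drawProb_eq_zero m cand _ ω p h)
  refine ⟨ω.1 p, draw_mem_opened ω p, ?_⟩
  -- Walk from the client to the common copy `g`, on to the cluster's center client, and then to the
  -- drawn copy. The legs are at most `r`, `R'` and `R'`, where the cluster radius `R'` is at most
  -- `r`.
  obtain ⟨g, hg, hg'⟩ := Finset.not_disjoint_iff.1 hd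
  have h1 := I.c_le_add (proj (ω.1 p)) (proj g) q.2 q'.2
  have h2 : I.c (proj (ω.1 p)) q'.2 ≤ I.radius proj (cand q') q'.2 := I.c_le_radius hp q'.2
  have h3 : I.c (proj g) q'.2 ≤ I.radius proj (cand q') q'.2 := I.c_le_radius hg' q'.2
  have h4 := I.radius_le (proj := proj) hne hr
  linarith [hr g hg]

end Fallback

/-! ### Tail bound for one client -/

section Analysis

variable {F C S : Type u} [Fintype F] [Fintype C] [Fintype S] [DecidableEq F]
  {X : Type v} [PseudoMetricSpace X] {I : Problem F C S X} {s : Sol F C S}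
  {G : Type u} [Fintype G] (R : Execution I s G)

namespace Execution

theorem cand_nonempty {A : S} {j : C} (hj : j ∈ I.clients A) : (R.cand (A, j)).Nonempty := by
  rw [Finset.nonempty_iff_ne_empty]
  intro h
  by_cases hf : R.t.FirstServed A j
  · simpa [h] using R.candI_sum A j hj hf
  · simpa [h] using R.candII_sum A j hj hf

/-- Candidates lie over the support of the original LP solution, which is where complementary
slackness bounds distances. -/
theorem x_pos_of_mem_cand {A : S} {j : C} (hj : j ∈ I.clients A) {g : G}
    (hg : g ∈ R.cand (A, j)) : 0 < s.x A (R.proj g) j := by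
  have h1 : 0 < R.t.x A g j := by
    by_cases hf : R.t.FirstServed A j
    · exact (R.candI_mem A j hj hf g hg).1.trans_le (min_le_left _ _)
    · have h2 := (R.candII_mem A j hj hf g hg).1
      have h3 : 0 ≤ R.t.xI A g j := le_min (R.split.x_nonneg A g j hj) (R.split.yI_nonneg g)
      rw [Sol.xII] at h2
      linarith
  have h2 := R.split.x_sum A (R.proj g) j hj
  have h3 := Finset.single_le_sum (f := fun g' => R.t.x A g' j)
    (s := Finset.univ.filter fun g' => R.proj g' = R.proj g)
    (fun g' _ => R.split.x_nonneg A g' j hj) (a := g) (by simp)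
  linarith

/-- Translates totals over copies back to the LP solution: opening costs, connection costs and, with
`f = 1`, the mass `T` of a client. -/
theorem sum_proj (f : F → ℝ) (a : F → ℝ) (b : G → ℝ)
    (h : ∀ i, ∑ g with R.proj g = i, b g = 2 * a i) :
    ∑ g, f (R.proj g) * b g = 2 * ∑ i, f i * a i := by
  rw [← Finset.sum_fiberwise Finset.univ R.proj, Finset.mul_sum]
  refine Finset.sum_congr rfl fun i _ => ?_
  rw [mul_left_comm, ← h i, Finset.mul_sum]
  refine Finset.sum_congr rfl fun g hg => ?_
  rw [(Finset.mem_filter.1 hg).2]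

variable [DecidableEq C] [DecidableEq S] [DecidableEq G]

theorem mass_centersI : ∀ p ∈ R.centersI, ∑ g ∈ R.cand p, R.t.yI g = 1 := by
  rintro ⟨A, j⟩ hp
  obtain ⟨hj, hf⟩ := (R.orderI_mem _).1 (mem_of_mem_greedyList (List.mem_toFinset.1 hp))
  rw [← R.candI_sum A j hj hf]
  exact Finset.sum_congr rfl fun g hg => (R.candI_mem A j hj hf g hg).2.symm

theorem mass_centersII (A : S) :
    ∀ p ∈ R.centersII A, ∑ g ∈ R.cand p, R.t.yII A g = 1 := by
  rintro ⟨A', j⟩ hp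
  obtain ⟨h, hj, hf⟩ := (R.orderII_mem A _).1 (mem_of_mem_greedyList (List.mem_toFinset.1 hp))
  dsimp only at h hj hf
  subst h
  rw [← R.candII_sum _ j hj hf]
  exact Finset.sum_congr rfl fun g hg => (R.candII_mem _ j hj hf g hg).2.symm

theorem disjoint_centersI : ∀ p ∈ R.centersI, ∀ q ∈ R.centersI, p ≠ q →
    Disjoint (R.cand p) (R.cand q) := fun _ hp _ hq =>
  disjoint_of_mem_greedyList (List.mem_toFinset.1 hp) (List.mem_toFinset.1 hq)

theorem disjoint_centersII (A : S) : ∀ p ∈ R.centersII A, ∀ q ∈ R.centersII A, p ≠ q →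
    Disjoint (R.cand p) (R.cand q) := fun _ hp _ hq =>
  disjoint_of_mem_greedyList (List.mem_toFinset.1 hp) (List.mem_toFinset.1 hq)

theorem sum_probI : ∑ ω, R.probI ω = 1 := drawProb_sum _ _ _ R.mass_centersI

theorem sum_probII (A : S) : ∑ ω, R.probII A ω = 1 := drawProb_sum _ _ _ (R.mass_centersII A)

theorem probI_nonneg (ω : Draws G R.centersI) : 0 ≤ R.probI ω :=
  drawProb_nonneg _ _ _ R.split.yI_nonneg R.split.yI_le_one ω

theorem probII_nonneg (A : S) (ω : Draws G (R.centersII A)) : 0 ≤ R.probII A ω :=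
  drawProb_nonneg _ _ _ (R.split.yII_nonneg A) (R.split.yII_le_one A) ω

/-- Every client finds an open facility within three times a bound on the distances to the
facilities that serve it fractionally. -/
theorem exists_open_c_le {A : S} {j : C} (hj : j ∈ I.clients A) {r : ℝ}
    (hr : ∀ i, 0 < s.x A i j → I.c i j ≤ r) {ω₁ : Draws G R.centersI}
    {ω₂ : Draws G (R.centersII A)} (h₁ : R.probI ω₁ ≠ 0) (h₂ : R.probII A ω₂ ≠ 0) :
    ∃ i ∈ R.openI ω₁ ∪ R.openII A ω₂, I.c i j ≤ 3 * r := by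
  have hc : ∀ g ∈ R.cand (A, j), I.c (R.proj g) j ≤ r :=
    fun g hg => hr _ (R.x_pos_of_mem_cand hj hg)
  by_cases hf : R.t.FirstServed A j
  · obtain ⟨g, hg, hgr⟩ := I.exists_opened_c_le R.orderI_sorted h₁
      ((R.orderI_mem (A, j)).2 ⟨hj, hf⟩) (R.cand_nonempty hj) hc
    exact ⟨R.proj g, Finset.mem_union_left _ (Finset.mem_image_of_mem _ hg), hgr⟩
  · obtain ⟨g, hg, hgr⟩ := I.exists_opened_c_le (R.orderII_sorted A) h₂
      ((R.orderII_mem A (A, j)).2 ⟨rfl, hj, hf⟩) (R.cand_nonempty hj) hc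
    exact ⟨R.proj g, Finset.mem_union_right _ (Finset.mem_image_of_mem _ hg), hgr⟩

theorem le_of_lt_nearest {A : S} {j : C} {r : ℝ} {ω₁ : Draws G R.centersI}
    {ω₂ : Draws G (R.centersII A)} (h : r < I.nearest (R.openI ω₁ ∪ R.openII A ω₂) j)
    {g : G} (hg : g ∈ opened R.cand R.centersI ω₁ ∨ g ∈ opened R.cand (R.centersII A) ω₂) :
    r < I.c (R.proj g) j := by
  refine h.trans_le (I.nearest_le ?_ j)
  exact Finset.mem_union.2 (hg.imp (Finset.mem_image_of_mem _) (Finset.mem_image_of_mem _))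

/-- Tail bound for the connection distance of a client. -/
theorem tail_nearest_le {A : S} {j : C} (hj : j ∈ I.clients A) (r : ℝ) :
    ∑ ω : Draws G R.centersI × Draws G (R.centersII A), R.probI ω.1 * R.probII A ω.2 *
        (if r < I.nearest (R.openI ω.1 ∪ R.openII A ω.2) j then 1 else 0)
      ≤ Real.exp (-∑ g with I.c (R.proj g) j ≤ r, R.t.x A g j) := by
  classical
  -- On copies that serve `j`, completeness gives `x = yI + yII`, so the exponent splits over the
  -- two independent stages.
  set B : Finset G := Finset.univ.filter fun g => I.c (R.proj g) j ≤ r ∧ R.t.x A g j ≠ 0 with hB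
  have e : ∑ g with I.c (R.proj g) j ≤ r, R.t.x A g j
      = ∑ g ∈ B, R.t.yI g + ∑ g ∈ B, R.t.yII A g := by
    rw [← Finset.sum_add_distrib, ← Finset.sum_filter_ne_zero, Finset.filter_filter]
    exact Finset.sum_congr rfl fun g hg =>
      (R.split.complete A g j hj).resolve_left (Finset.mem_filter.1 hg).2.2
  rw [e, neg_add, Real.exp_add]
  refine le_trans ?_ (mul_le_mul
    (prob_disjoint_opened_le R.split.yI_nonneg R.split.yI_le_one R.mass_centersI B)
    (prob_disjoint_opened_le (R.split.yII_nonneg A) (R.split.yII_le_one A)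
      (R.mass_centersII A) B) (Finset.sum_nonneg fun ω _ =>
        mul_nonneg (R.probII_nonneg A ω) (by split_ifs <;> norm_num)) (Real.exp_pos _).le)
  rw [Fintype.sum_mul_sum, Fintype.sum_prod_type]
  refine Finset.sum_le_sum fun ω₁ _ => Finset.sum_le_sum fun ω₂ _ => ?_
  have n1 := R.probI_nonneg ω₁
  have n2 := R.probII_nonneg A ω₂
  rw [mul_mul_mul_comm]
  refine mul_le_mul_of_nonneg_left ?_ (mul_nonneg n1 n2)
  by_cases h : r < I.nearest (R.openI ω₁ ∪ R.openII A ω₂) j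
  · have d1 : Disjoint (opened R.cand R.centersI ω₁) B := Finset.disjoint_left.2 fun g hg hgB =>
      absurd (R.le_of_lt_nearest h (Or.inl hg)) (not_lt.2 (Finset.mem_filter.1 hgB).2.1)
    have d2 : Disjoint (opened R.cand (R.centersII A) ω₂) B :=
      Finset.disjoint_left.2 fun g hg hgB =>
        absurd (R.le_of_lt_nearest h (Or.inr hg)) (not_lt.2 (Finset.mem_filter.1 hgB).2.1)
    rw [if_pos h, if_pos d1, if_pos d2, mul_one]
  · rw [if_neg h]
    exact mul_nonneg (by split_ifs <;> norm_num) (by split_ifs <;> norm_num)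

end Execution

end Analysis

/-! ### Expected costs -/

section Bounds

variable {F C S : Type u} [Fintype F] [Fintype C] [Fintype S] [DecidableEq F]
  {X : Type v} [PseudoMetricSpace X] {I : Problem F C S X} {s : Sol F C S}
  {G : Type u} [Fintype G] [DecidableEq C] [DecidableEq S] [DecidableEq G]
  (R : Execution I s G)

/-- On `[0, T]` the convex function `exp (-x)` lies below its chord. -/
theorem exp_neg_le_chord {x T : ℝ} (hT : 0 < T) (hx : 0 ≤ x) (hxT : x ≤ T) :
    Real.exp (-x) ≤ 1 - x / T * (1 - Real.exp (-T)) := by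
  have h := convexOn_exp.2 (Set.mem_univ 0) (Set.mem_univ (-T))
    (sub_nonneg.2 ((div_le_one hT).2 hxT)) (div_nonneg hx hT.le)
    (sub_add_cancel _ _)
  have e : (1 - x / T) • (0 : ℝ) + (x / T) • (-T) = -x := by
    simp only [smul_eq_mul]
    field_simp
    ring
  rw [e, Real.exp_zero, smul_eq_mul, smul_eq_mul] at h
  linarith

namespace Execution

/-- Bound on the expected connection cost of a client. -/
theorem expected_nearest_le (hs : I.PrimalFeasible s) {A : S} {j : C} (hj : j ∈ I.clients A)
    {r : ℝ} (h0 : 0 ≤ r) (hr : ∀ i, 0 < s.x A i j → I.c i j ≤ r) :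
    ∑ ω : Draws G R.centersI × Draws G (R.centersII A), R.probI ω.1 * R.probII A ω.2 *
        I.nearest (R.openI ω.1 ∪ R.openII A ω.2) j
      ≤ 3 * Real.exp (-2) * r + (1 - Real.exp (-2)) * ∑ i, I.c i j * s.x A i j := by
  set T := ∑ g, R.t.x A g j with hT
  have hx := fun g => R.split.x_nonneg A g j hj
  have hT2 : 2 ≤ T := by
    have := R.sum_proj (fun _ => 1) (fun i => s.x A i j) (fun g => R.t.x A g j)
      (fun i => R.split.x_sum A i j hj)
    simp only [one_mul] at this
    linarith [hs.covered A j hj]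
  have hT0 : 0 < T := by linarith
  set κ := 1 - Real.exp (-T) with hκ
  have hκ0 : Real.exp (-T) ≤ Real.exp (-2) := Real.exp_le_exp.2 (by linarith)
  have he2 : Real.exp (-2) ≤ 1 := Real.exp_le_one_iff.2 (by norm_num)
  have hD : 0 ≤ 3 * r := by linarith
  have hc := fun g => I.c_nonneg (R.proj g) j
  -- The chord bound `1 - (m / T) * κ` is rewritten as `exp (-T) + κ * (1 - m / T)`; the last factor
  -- is the tail of the distance with weights `x / T`.
  have htail := sum_min_le_of_tail_le
    (fun ω : Draws G R.centersI × Draws G (R.centersII A) => R.probI ω.1 * R.probII A ω.2)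
    (fun ω => I.nearest (R.openI ω.1 ∪ R.openII A ω.2) j)
    (fun g => κ * (R.t.x A g j / T)) (fun g => I.c (R.proj g) j) (K := Real.exp (-T)) hD
    (fun _ => I.nearest_nonneg _ _) hc (fun ρ => by
      refine (R.tail_nearest_le hj ρ).trans ((exp_neg_le_chord hT0
        (Finset.sum_nonneg fun g _ => hx g) ?_).trans (le_of_eq ?_))
      · exact Finset.sum_le_sum_of_subset_of_nonneg (Finset.filter_subset _ _) fun g _ _ => hx g
      · have e : ∑ g, R.t.x A g j * (if ρ < I.c (R.proj g) j then 1 else 0)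
            = T - ∑ g with I.c (R.proj g) j ≤ ρ, R.t.x A g j := by
          rw [hT, Finset.sum_filter, ← Finset.sum_sub_distrib]
          refine Finset.sum_congr rfl fun g _ => ?_
          rcases le_or_gt (I.c (R.proj g) j) ρ with h | h
          · simp [h, not_lt.2 h]
          · simp [h, not_le.2 h]
        have e' : ∑ g, κ * (R.t.x A g j / T) * (if ρ < I.c (R.proj g) j then 1 else 0)
            = κ / T * ∑ g, R.t.x A g j * (if ρ < I.c (R.proj g) j then 1 else 0) := by
          rw [Finset.mul_sum]
          exact Finset.sum_congr rfl fun g _ => by ring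
        rw [e', e, hκ]
        field_simp
        ring)
  -- Truncation at `3 * r` changes nothing on outcomes of nonzero probability, by the fallback
  -- facility.
  have hfall : ∀ ω : Draws G R.centersI × Draws G (R.centersII A),
      R.probI ω.1 * R.probII A ω.2 * I.nearest (R.openI ω.1 ∪ R.openII A ω.2) j
        = R.probI ω.1 * R.probII A ω.2 *
          min (I.nearest (R.openI ω.1 ∪ R.openII A ω.2) j) (3 * r) := by
    intro ω
    by_cases h₁ : R.probI ω.1 = 0
    · simp [h₁]
    by_cases h₂ : R.probII A ω.2 = 0
    · simp [h₂]
    obtain ⟨i, hi, hir⟩ := R.exists_open_c_le hj hr h₁ h₂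
    rw [min_eq_left ((I.nearest_le hi j).trans hir)]
  rw [Finset.sum_congr rfl fun ω _ => hfall ω]
  refine htail.trans ?_
  set d := ∑ g, R.t.x A g j / T * min (I.c (R.proj g) j) (3 * r) with hd
  have e1 : ∑ g, κ * (R.t.x A g j / T) * min (I.c (R.proj g) j) (3 * r) = κ * d := by
    rw [hd, Finset.mul_sum]
    exact Finset.sum_congr rfl fun g _ => by ring
  have hd1 : d ≤ 3 * r := by
    calc d ≤ ∑ g, R.t.x A g j / T * (3 * r) := Finset.sum_le_sum fun g _ =>
          mul_le_mul_of_nonneg_left (min_le_right _ _) (div_nonneg (hx g) hT0.le)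
      _ = 3 * r := by
          rw [← Finset.sum_mul, ← Finset.sum_div, ← hT, div_self hT0.ne', one_mul]
  -- The weights are the doubled assignment divided by `T ≥ 2`.
  have hd2 : d ≤ ∑ i, I.c i j * s.x A i j := by
    have e2 := R.sum_proj (fun i => I.c i j) (fun i => s.x A i j) (fun g => R.t.x A g j)
      (fun i => R.split.x_sum A i j hj)
    have hn : 0 ≤ ∑ g, I.c (R.proj g) j * R.t.x A g j :=
      Finset.sum_nonneg fun g _ => mul_nonneg (hc g) (hx g)
    calc d ≤ ∑ g, (I.c (R.proj g) j * R.t.x A g j) / T := Finset.sum_le_sum fun g _ => by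
          rw [mul_comm (I.c _ _), mul_div_right_comm]
          exact mul_le_mul_of_nonneg_left (min_le_left _ _) (div_nonneg (hx g) hT0.le)
      _ = (∑ g, I.c (R.proj g) j * R.t.x A g j) / T := by rw [Finset.sum_div]
      _ ≤ (∑ g, I.c (R.proj g) j * R.t.x A g j) / 2 :=
          div_le_div_of_nonneg_left hn (by norm_num) hT2
      _ = ∑ i, I.c i j * s.x A i j := by linarith
  rw [e1, hκ]
  -- The bound `exp (-T) * 3r + (1 - exp (-T)) * d` is nondecreasing in `exp (-T)` because `d ≤ 3r`,
  -- so `exp (-2)` may replace `exp (-T)`.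
  have h1 := mul_le_mul_of_nonneg_right hκ0 (sub_nonneg.2 hd1)
  have h2 := mul_le_mul_of_nonneg_left hd2 (sub_nonneg.2 he2)
  linarith

theorem expCostIn_eq (A : S) : R.expCostIn A =
    ∑ ω, R.probI ω * ∑ i ∈ R.openI ω, I.openI i
      + ∑ ω, R.probII A ω * ∑ i ∈ R.openII A ω, I.openII A i
      + ∑ j ∈ I.clients A, ∑ ω : Draws G R.centersI × Draws G (R.centersII A),
        R.probI ω.1 * R.probII A ω.2 * I.nearest (R.openI ω.1 ∪ R.openII A ω.2) j := by
  simp only [expCostIn, Problem.roundedCost, mul_add, Finset.sum_add_distrib]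
  congr 1
  · congr 1
    · refine Finset.sum_congr rfl fun ω₁ _ => ?_
      rw [← mul_one (R.probI ω₁ * _), ← R.sum_probII A, Finset.mul_sum]
      exact Finset.sum_congr rfl fun ω₂ _ => by ring
    · rw [Finset.sum_comm]
      refine Finset.sum_congr rfl fun ω₂ _ => ?_
      rw [← one_mul (R.probII A ω₂ * _), ← R.sum_probI, Finset.sum_mul]
      exact Finset.sum_congr rfl fun ω₁ _ => by ring
  · simp only [Finset.mul_sum]
    rw [Finset.sum_comm (s := I.clients A)]
    exact (Fintype.sum_prod_type (fun ω : Draws G R.centersI × Draws G (R.centersII A) =>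
      ∑ j ∈ I.clients A, R.probI ω.1 * R.probII A ω.2 *
        I.nearest (R.openI ω.1 ∪ R.openII A ω.2) j)).symm

/-- Bound on the expected cost in a scenario, in terms of bounds on the distances to the
facilities that serve the clients fractionally. -/
theorem expCostIn_le (hs : I.PrimalFeasible s) {A : S} (r : C → ℝ)
    (h0 : ∀ j ∈ I.clients A, 0 ≤ r j)
    (hr : ∀ j ∈ I.clients A, ∀ i, 0 < s.x A i j → I.c i j ≤ r j) :
    R.expCostIn A ≤ 3 * Real.exp (-2) * ∑ j ∈ I.clients A, r j
      + (1 - Real.exp (-2)) * I.conCost s A + 2 * I.facCost s A := by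
  have h1 : ∑ ω, R.probI ω * ∑ i ∈ R.openI ω, I.openI i ≤ 2 * ∑ i, I.openI i * s.yI i :=
    (expected_open_le R.split.yI_nonneg R.split.yI_le_one R.mass_centersI R.disjoint_centersI
      R.proj I.openI_nonneg).trans_eq (R.sum_proj _ _ _ R.split.yI_sum)
  have h2 : ∑ ω, R.probII A ω * ∑ i ∈ R.openII A ω, I.openII A i
      ≤ 2 * ∑ i, I.openII A i * s.yII A i :=
    (expected_open_le (R.split.yII_nonneg A) (R.split.yII_le_one A) (R.mass_centersII A)
      (R.disjoint_centersII A) R.proj (I.openII_nonneg A)).trans_eq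
      (R.sum_proj _ _ _ (R.split.yII_sum A))
  have h3 := Finset.sum_le_sum fun j (hj : j ∈ I.clients A) =>
    R.expected_nearest_le hs hj (h0 j hj) (hr j hj)
  rw [Finset.sum_add_distrib, ← Finset.mul_sum, ← Finset.mul_sum] at h3
  rw [R.expCostIn_eq, Problem.facCost, Problem.conCost, Finset.sum_add_distrib]
  linarith

theorem expCostIn_le_of_dual (hs : I.PrimalFeasible s) {d : DualSol F C S}
    (hd : I.DualFeasible d)
    (h : I.totalFac s + I.totalCon s ≤ ∑ A, I.prob A * I.budget d A)
    {A : S} (hA : 0 < I.prob A) :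
    R.expCostIn A ≤ 3 * Real.exp (-2) * I.budget d A
      + (1 - Real.exp (-2)) * I.conCost s A + 2 * I.facCost s A :=
  R.expCostIn_le hs (d.v A) (hd.v_nonneg A) fun _ hj _ hx => I.c_le_of_x_pos hs hd h hA hj hx

/-- Null scenarios contribute nothing, and the expected budget is at most `F* + C*` by weak duality.
Thus `3e⁻²` is added to both coefficients `2` and `1 - e⁻²`. -/
theorem expCost_le (hs : I.PrimalOptimal s) :
    R.expCost ≤ (2 + 3 * Real.exp (-2)) * I.totalFac s
      + (1 + 2 * Real.exp (-2)) * I.totalCon s := by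
  obtain ⟨d, hd, h⟩ := I.exists_dual_ge hs
  have key : R.expCost ≤ ∑ A, I.prob A * (3 * Real.exp (-2) * I.budget d A
      + (1 - Real.exp (-2)) * I.conCost s A + 2 * I.facCost s A) := by
    refine Finset.sum_le_sum fun A _ => ?_
    rcases (I.prob_nonneg A).eq_or_lt with hA | hA
    · simp [← hA]
    · exact mul_le_mul_of_nonneg_left (R.expCostIn_le_of_dual hs.1 hd h hA) hA.le
  have e1 : ∑ A, I.prob A * I.facCost s A = I.totalFac s := by
    simp only [Problem.facCost, Problem.totalFac, Finset.sum_add_distrib, mul_add]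
    rw [← Finset.sum_mul, I.prob_sum, one_mul]
  have e2 : ∑ A, I.prob A * I.conCost s A = I.totalCon s := rfl
  have e3 : ∑ A, I.prob A * (3 * Real.exp (-2) * I.budget d A
      + (1 - Real.exp (-2)) * I.conCost s A + 2 * I.facCost s A)
      = 3 * Real.exp (-2) * ∑ A, I.prob A * I.budget d A
        + (1 - Real.exp (-2)) * ∑ A, I.prob A * I.conCost s A
        + 2 * ∑ A, I.prob A * I.facCost s A := by
    simp only [Finset.mul_sum, ← Finset.sum_add_distrib]
    exact Finset.sum_congr rfl fun A _ => by ring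
  rw [e3, e1, e2] at key
  have h2 := mul_le_mul_of_nonneg_left (I.budget_le hs.1 hd)
    (mul_nonneg (by norm_num : (0 : ℝ) ≤ 3) (Real.exp_pos (-2)).le)
  linarith

end Execution

/-- For `t = 0.13535`, `1 + 2t` is exactly `1.2707` and `2 + 3t = 2.40605`. -/
theorem exp_neg_two_lt : Real.exp (-2) < 0.13535 := by
  have h1 := Real.exp_one_gt_d9
  have h2 : Real.exp (-2) = (Real.exp 1 * Real.exp 1)⁻¹ := by
    rw [← Real.exp_add, ← Real.exp_neg]
    norm_num
  rw [h2, inv_lt_comm₀ (by positivity) (by norm_num)]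
  calc (0.13535 : ℝ)⁻¹ < 2.7182818283 * 2.7182818283 := by norm_num
    _ < _ := by gcongr

end Bounds

/-! ### Cutting the line at breakpoints; sorting -/

section Breakpoints

/-- A finite set of nonnegative reals cuts the line into finitely many pieces of positive length at
most 1, such that every member of the set is the total length of the pieces to its left. -/
theorem exists_pieces (B : Finset ℝ) (hB : ∀ t ∈ B, 0 ≤ t) :
    ∃ (K : Type u) (_ : Fintype K) (lo w : K → ℝ), (∀ k, 0 < w k) ∧ (∀ k, w k ≤ 1) ∧
      ∀ t ∈ B, ∑ k, (if lo k < t then w k else 0) = t := by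
  classical
  obtain ⟨M, hM⟩ : ∃ M : ℕ, ∀ t ∈ B, t ≤ M := by
    obtain ⟨M, hM⟩ := exists_nat_ge (∑ t ∈ B, t)
    exact ⟨M, fun t ht => (Finset.single_le_sum (f := fun t => t) hB ht).trans hM⟩
  -- The integers from 0 to `M` keep neighbouring breakpoints within distance 1 and make the first
  -- one 0.
  set B' : Finset ℝ := B ∪ (Finset.range (M + 1)).image Nat.cast with hB'
  have hnat : ∀ n : ℕ, n ≤ M → (n : ℝ) ∈ B' := fun n hn =>
    Finset.mem_union_right _ (Finset.mem_image_of_mem _ (Finset.mem_range.2 (by omega)))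
  have hrange : ∀ t ∈ B', 0 ≤ t ∧ t ≤ M := by
    intro t ht
    rcases Finset.mem_union.1 ht with ht | ht
    · exact ⟨hB t ht, hM t ht⟩
    · obtain ⟨n, hn, rfl⟩ := Finset.mem_image.1 ht
      exact ⟨n.cast_nonneg, by exact_mod_cast Nat.lt_succ_iff.1 (Finset.mem_range.1 hn)⟩
  have hcard : 0 < B'.card := Finset.card_pos.2 ⟨_, hnat 0 (Nat.zero_le _)⟩
  -- Breakpoints in increasing order; the `min` makes the sequence constant after the last one.
  let e : ℕ → ℝ := fun k => B'.orderEmbOfFin rfl ⟨min k (B'.card - 1), by omega⟩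
  have he : ∀ k, e k ∈ B' := fun k => Finset.orderEmbOfFin_mem _ _ _
  have hmono : Monotone e := fun k l hkl => (B'.orderEmbOfFin rfl).monotone <| by
    rw [Fin.mk_le_mk]
    omega
  have hcut : ∀ t ∈ B', ∃ i < B'.card, (∀ k, i ≤ k → t ≤ e k) ∧ ∀ k, k ≤ i → e k ≤ t := by
    intro t ht
    have : t ∈ Set.range (B'.orderEmbOfFin rfl) := by
      rw [Finset.range_orderEmbOfFin]
      exact ht
    obtain ⟨i, rfl⟩ := this
    refine ⟨i, i.2, fun k hk => (B'.orderEmbOfFin rfl).monotone ?_,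
      fun k hk => (B'.orderEmbOfFin rfl).monotone ?_⟩ <;>
    · rw [Fin.le_def]
      have := i.2
      simp only
      omega
  have hstep : ∀ t ∈ B', ∀ k, e (k + 1) ≤ t ∨ t ≤ e k := by
    intro t ht k
    obtain ⟨i, -, h1, h2⟩ := hcut t ht
    rcases le_or_gt i k with h | h
    · exact Or.inr (h1 k h)
    · exact Or.inl (h2 (k + 1) h)
  refine ⟨ULift (Fin (B'.card - 1)), inferInstance, fun k => e k.down,
    fun k => e (k.down + 1) - e k.down, fun k => ?_, fun k => ?_, fun t ht => ?_⟩
  · rw [sub_pos]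
    refine (B'.orderEmbOfFin rfl).strictMono ?_
    rw [Fin.mk_lt_mk]
    have := k.down.2
    omega
  · rw [sub_le_iff_le_add']
    rcases lt_or_ge (e k.down) M with h | h
    · have h1 : ⌊e k.down⌋₊ < M := (Nat.floor_lt (hrange _ (he _)).1).2 h
      rcases hstep _ (hnat (⌊e k.down⌋₊ + 1) h1) k.down with h2 | h2
      · push_cast at h2
        linarith [Nat.floor_le (hrange _ (he k.down)).1]
      · push_cast at h2
        linarith [Nat.lt_floor_add_one (e k.down)]
    · linarith [(hrange _ (he (k.down + 1))).2]
  · have ht' : t ∈ B' := Finset.mem_union_left _ ht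
    -- No breakpoint lies strictly between neighbours, so the pieces left of `t` telescope to `t -
    -- 0`.
    have h1 : ∀ k, (if e k < t then e (k + 1) - e k else 0) = min (e (k + 1)) t - min (e k) t := by
      intro k
      have := hmono (Nat.le_succ k)
      rcases hstep t ht' k with h | h
      · rw [min_eq_left h, min_eq_left (this.trans h)]
        split_ifs with h'
        · rfl
        · have : e k ≤ e (k + 1) := this
          linarith
      · rw [min_eq_right h, min_eq_right (h.trans this), if_neg (not_lt.2 h), sub_self]
    refine (Equiv.ulift.sum_comp (fun k : Fin (B'.card - 1) =>
      if e k < t then e (k + 1) - e k else 0)).trans ?_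
    rw [Fin.sum_univ_eq_sum_range (fun k => if e k < t then e (k + 1) - e k else 0),
      Finset.sum_congr rfl fun k _ => h1 k, Finset.sum_range_sub (fun k => min (e k) t)]
    obtain ⟨i, hi, h2, -⟩ := hcut t ht'
    obtain ⟨i₀, -, -, h3⟩ := hcut 0 (by simpa using hnat 0 (Nat.zero_le _))
    have h4 : e 0 = 0 := le_antisymm (h3 0 (Nat.zero_le _)) (hrange _ (he 0)).1
    rw [min_eq_right (h2 _ (by omega)), h4, min_eq_left (hB t ht), sub_zero]

/-- A finite set can be listed by nondecreasing value of a function. -/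
theorem exists_sorted_list {P : Type u} (ρ : P → ℝ) (T : Finset P) :
    ∃ l : List P, l.Nodup ∧ (∀ q, q ∈ l ↔ q ∈ T) ∧ l.Pairwise fun q r => ρ q ≤ ρ r := by
  classical
  induction T using Finset.induction_on_max_value ρ with
  | empty => exact ⟨[], by simp⟩
  | insert a T ha hmax ih =>
    obtain ⟨l, h1, h2, h3⟩ := ih
    refine ⟨l ++ [a], ?_, fun q => ?_, ?_⟩
    · rw [List.nodup_append]
      refine ⟨h1, List.nodup_singleton a, ?_⟩
      intro b hb c hc
      rw [List.mem_singleton] at hc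
      subst hc
      rintro rfl
      exact ha ((h2 _).1 hb)
    · simp [h2, or_comm]
    · rw [List.pairwise_append]
      refine ⟨h3, List.pairwise_singleton _ a, ?_⟩
      intro b hb c hc
      rw [List.mem_singleton] at hc
      subst hc
      exact hmax b ((h2 b).1 hb)

end Breakpoints

/-! ### The doubled and split solution -/

section Splitting

variable {F C S : Type u} {K : Type u} {lo w : K → ℝ} {s : Sol F C S}

/-- The part of the weight of piece `k` that lies to the left of `t`. -/
noncomputable def layer (lo w : K → ℝ) (t : ℝ) (k : K) : ℝ :=
  if lo k < t then w k else 0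

theorem layer_nonneg (hw : ∀ k, 0 < w k) (t : ℝ) (k : K) : 0 ≤ layer lo w t k := by
  unfold layer
  split_ifs
  exacts [(hw k).le, le_rfl]

theorem layer_mono (hw : ∀ k, 0 < w k) {t t' : ℝ} (h : t ≤ t') (k : K) :
    layer lo w t k ≤ layer lo w t' k := by
  unfold layer
  split_ifs with h1 h2
  exacts [le_rfl, absurd (h1.trans_le h) h2, (hw k).le, le_rfl]

theorem layer_le_one (hw : ∀ k, w k ≤ 1) (t : ℝ) (k : K) : layer lo w t k ≤ 1 := by
  unfold layer
  split_ifs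
  exacts [hw k, zero_le_one]

theorem layer_eq_of_lt {t : ℝ} {k : K} (h : lo k < t) : layer lo w t k = w k := if_pos h

/-- Pieces are never cut by the thresholds in use, and smaller thresholds select initial segments of
larger ones; this yields the condition `complete`. -/
theorem layer_eq_zero_or {t t' : ℝ} (h : t ≤ t') (k : K) :
    layer lo w t k = 0 ∨ layer lo w t k = layer lo w t' k := by
  rcases lt_or_ge (lo k) t with h1 | h1
  · right
    rw [layer_eq_of_lt h1, layer_eq_of_lt (h1.trans_le h)]
  · left
    exact if_neg (not_lt.2 h1)

/-- First-stage part of the doubled assignment. -/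
noncomputable def Sol.doubleI (s : Sol F C S) (A : S) (j : C) (i : F) : ℝ :=
  min (2 * s.x A i j) (2 * s.yI i)

/-- Second-stage part of the doubled assignment. -/
noncomputable def Sol.doubleII (s : Sol F C S) (A : S) (j : C) (i : F) : ℝ :=
  2 * s.x A i j - s.doubleI A j i

theorem doubleI_le (s : Sol F C S) (A : S) (j : C) (i : F) : s.doubleI A j i ≤ 2 * s.yI i :=
  min_le_right _ _

theorem doubleII_nonneg (s : Sol F C S) (A : S) (j : C) (i : F) : 0 ≤ s.doubleII A j i :=
  sub_nonneg.2 (min_le_left _ _)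

/-- The doubled solution on the copies `(i, k)` of facility `i`, one copy for each stage. -/
noncomputable def Sol.splitting (s : Sol F C S) (lo w : K → ℝ) :
    Sol (F × K ⊕ F × K) C S where
  yI := Sum.elim (fun q => layer lo w (2 * s.yI q.1) q.2) fun _ => 0
  yII A := Sum.elim (fun _ => 0) fun q => layer lo w (2 * s.yII A q.1) q.2
  x A g j := Sum.elim (fun q => layer lo w (s.doubleI A j q.1) q.2)
    (fun q => layer lo w (s.doubleII A j q.1) q.2) g

theorem Sol.splitting_xI_inl (hw : ∀ k, 0 < w k) (A : S) (q : F × K) (j : C) :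
    (s.splitting lo w).xI A (Sum.inl q) j = layer lo w (s.doubleI A j q.1) q.2 :=
  min_eq_left (layer_mono hw (min_le_right _ _) _)

theorem Sol.splitting_xI_inr (hw : ∀ k, 0 < w k) (A : S) (q : F × K) (j : C) :
    (s.splitting lo w).xI A (Sum.inr q) j = 0 :=
  min_eq_right (layer_nonneg hw _ _)

theorem Sol.splitting_xII_inr (hw : ∀ k, 0 < w k) (A : S) (q : F × K) (j : C) :
    (s.splitting lo w).xII A (Sum.inr q) j = layer lo w (s.doubleII A j q.1) q.2 := by
  rw [Sol.xII, Sol.splitting_xI_inr hw, sub_zero]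
  rfl

end Splitting

/-! ### Existence of an execution -/

section Existence

variable {F C S : Type u} [Fintype F] [Fintype C] [Fintype S]
  {X : Type v} [PseudoMetricSpace X] {I : Problem F C S X} {s : Sol F C S}

variable {K : Type u} [Fintype K] {lo w : K → ℝ}

theorem doubleI_nonneg (hs : I.PrimalFeasible s) {A : S} {j : C} (hj : j ∈ I.clients A) (i : F) :
    0 ≤ s.doubleI A j i :=
  le_min (by linarith [hs.x_nonneg A i j hj]) (by linarith [hs.yI_nonneg i])

/-- The second-stage part is either 0 or `2 * (x - yI)`, and `x ≤ yI + yII`. -/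
theorem doubleII_le (hs : I.PrimalFeasible s) {A : S} {j : C} (hj : j ∈ I.clients A) (i : F) :
    s.doubleII A j i ≤ 2 * s.yII A i := by
  have h1 := hs.le_open A i j hj
  have h2 := hs.yII_nonneg A i
  unfold Sol.doubleII Sol.doubleI
  rcases min_cases (2 * s.x A i j) (2 * s.yI i) with h | h <;> rw [h.1] <;> linarith

theorem sum_fiber [DecidableEq F] (f : F × K ⊕ F × K → ℝ) (i : F) :
    ∑ g with Sum.elim Prod.fst Prod.fst g = i, f g
      = ∑ k, f (Sum.inl (i, k)) + ∑ k, f (Sum.inr (i, k)) := by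
  rw [Finset.sum_filter, Fintype.sum_sum_type, Fintype.sum_prod_type, Fintype.sum_prod_type]
  simp only [Sum.elim_inl, Sum.elim_inr]
  congr 1 <;>
  · rw [Finset.sum_eq_single i (fun i' _ hi => by simp [hi]) (by simp)]
    simp

theorem isScaledSplit [DecidableEq F] (hs : I.PrimalFeasible s) (hw : ∀ k, 0 < w k)
    (hw1 : ∀ k, w k ≤ 1)
    (hyI : ∀ i, ∑ k, layer lo w (2 * s.yI i) k = 2 * s.yI i)
    (hyII : ∀ A i, ∑ k, layer lo w (2 * s.yII A i) k = 2 * s.yII A i)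
    (hxI : ∀ A i, ∀ j ∈ I.clients A, ∑ k, layer lo w (s.doubleI A j i) k = s.doubleI A j i)
    (hxII : ∀ A i, ∀ j ∈ I.clients A, ∑ k, layer lo w (s.doubleII A j i) k = s.doubleII A j i) :
    I.IsScaledSplit s (Sum.elim Prod.fst Prod.fst) (s.splitting lo w) where
  x_nonneg A g j _ := by
    rcases g with q | q <;> exact layer_nonneg hw _ _
  yI_nonneg g := by
    rcases g with q | q
    exacts [layer_nonneg hw _ _, le_rfl]
  yII_nonneg A g := by
    rcases g with q | q
    exacts [le_rfl, layer_nonneg hw _ _]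
  yI_sum i := by
    rw [sum_fiber]
    simpa [Sol.splitting] using hyI i
  yII_sum A i := by
    rw [sum_fiber]
    simpa [Sol.splitting] using hyII A i
  x_sum A i j hj := by
    rw [sum_fiber]
    simp only [Sol.splitting, Sum.elim_inl, Sum.elim_inr]
    rw [hxI A i j hj, hxII A i j hj, Sol.doubleII]
    ring
  one_stage g := by
    rcases g with q | q
    exacts [Or.inr fun _ => rfl, Or.inl rfl]
  yI_le_one g := by
    rcases g with q | q
    exacts [layer_le_one hw1 _ _, zero_le_one]
  yII_le_one A g := by
    rcases g with q | q
    exacts [zero_le_one, layer_le_one hw1 _ _]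
  complete A g j hj := by
    rcases g with q | q
    · simpa [Sol.splitting] using layer_eq_zero_or (doubleI_le s A j q.1) q.2
    · simpa [Sol.splitting] using layer_eq_zero_or (doubleII_le hs hj q.1) q.2

/-- The normalization of a nonnegative vector to total 1. -/
noncomputable def normalized (a : F → ℝ) (i : F) : ℝ := a i / ∑ i', a i'

theorem normalized_nonneg {a : F → ℝ} (h : ∀ i, 0 ≤ a i) (i : F) : 0 ≤ normalized a i :=
  div_nonneg (h i) (Finset.sum_nonneg fun i _ => h i)

theorem normalized_le {a : F → ℝ} (h : ∀ i, 0 ≤ a i) (h1 : 1 ≤ ∑ i, a i) (i : F) :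
    normalized a i ≤ a i := div_le_self (h i) h1

theorem sum_normalized {a : F → ℝ} (h1 : 1 ≤ ∑ i, a i) : ∑ i, normalized a i = 1 := by
  simp only [normalized]
  rw [← Finset.sum_div, div_self (by linarith)]

/-- The pieces to the left of the normalized vector have total weight 1. -/
theorem sum_layer_normalized {a : F → ℝ} (h : ∀ i, 0 ≤ a i) (h1 : 1 ≤ ∑ i, a i)
    (hB : ∀ i, ∑ k, layer lo w (normalized a i) k = normalized a i) :
    ∑ q : F × K with lo q.2 < normalized a q.1, layer lo w (a q.1) q.2 = 1 := by
  rw [← sum_normalized h1, Finset.sum_filter, Fintype.sum_prod_type]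
  refine Finset.sum_congr rfl fun i _ => ?_
  rw [← hB i]
  refine Finset.sum_congr rfl fun k _ => ?_
  dsimp only
  split_ifs with h2
  · rw [layer_eq_of_lt h2, layer_eq_of_lt (h2.trans_le (normalized_le h h1 i))]
  · exact (if_neg h2).symm

theorem exists_execution [DecidableEq F] (hs : I.PrimalFeasible s) :
    ∃ (G : Type u) (_ : Fintype G), Nonempty (Execution I s G) := by
  classical
  -- Normalized vectors are included so that candidate sets can have mass exactly 1. The filter
  -- discards negative values, which can arise from inactive clients.
  let B : Finset ℝ := ((Finset.univ.image fun i => 2 * s.yI i)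
    ∪ (Finset.univ.image fun q : S × F => 2 * s.yII q.1 q.2)
    ∪ (Finset.univ.image fun q : S × C × F => s.doubleI q.1 q.2.1 q.2.2)
    ∪ (Finset.univ.image fun q : S × C × F => s.doubleII q.1 q.2.1 q.2.2)
    ∪ (Finset.univ.image fun q : S × C × F => normalized (s.doubleI q.1 q.2.1) q.2.2)
    ∪ (Finset.univ.image fun q : S × C × F => normalized (s.doubleII q.1 q.2.1) q.2.2)).filter
      (0 ≤ ·)
  obtain ⟨K, _, lo, w, hw, hw1, hB⟩ := exists_pieces.{u} B fun t ht => (Finset.mem_filter.1 ht).2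
  have hL : ∀ t ∈ B, ∑ k, layer lo w t k = t := hB
  have hmem : ∀ t, t ∈ B ↔ _ := fun t => Finset.mem_filter
  simp only [Finset.mem_union, Finset.mem_image, Finset.mem_univ, true_and] at hmem
  have nI := fun A j (hj : j ∈ I.clients A) => doubleI_nonneg hs hj
  have nII := fun A j => doubleII_nonneg s A j
  have hyI : ∀ i, ∑ k, layer lo w (2 * s.yI i) k = 2 * s.yI i := fun i => hL _ <| by
    rw [hmem]
    exact ⟨by simp, by linarith [hs.yI_nonneg i]⟩
  have hyII : ∀ A i, ∑ k, layer lo w (2 * s.yII A i) k = 2 * s.yII A i := fun A i => hL _ <| by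
    rw [hmem]
    exact ⟨Or.inl <| Or.inl <| Or.inl <| Or.inl <| Or.inr ⟨(A, i), rfl⟩,
      by linarith [hs.yII_nonneg A i]⟩
  have hxI : ∀ A i, ∀ j ∈ I.clients A,
      ∑ k, layer lo w (s.doubleI A j i) k = s.doubleI A j i := fun A i j hj => hL _ <| by
    rw [hmem]
    exact ⟨Or.inl <| Or.inl <| Or.inl <| Or.inr ⟨(A, j, i), rfl⟩, nI A j hj i⟩
  have hxII : ∀ A i, ∀ j ∈ I.clients A,
      ∑ k, layer lo w (s.doubleII A j i) k = s.doubleII A j i := fun A i j _ => hL _ <| by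
    rw [hmem]
    exact ⟨Or.inl <| Or.inl <| Or.inr ⟨(A, j, i), rfl⟩, nII A j i⟩
  have hnI : ∀ A i, ∀ j ∈ I.clients A, ∑ k, layer lo w (normalized (s.doubleI A j) i) k
      = normalized (s.doubleI A j) i := fun A i j hj => hL _ <| by
    rw [hmem]
    exact ⟨Or.inl <| Or.inr ⟨(A, j, i), rfl⟩, normalized_nonneg (nI A j hj) i⟩
  have hnII : ∀ A i, ∀ j ∈ I.clients A, ∑ k, layer lo w (normalized (s.doubleII A j) i) k
      = normalized (s.doubleII A j) i := fun A i j _ => hL _ <| by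
    rw [hmem]
    exact ⟨Or.inr ⟨(A, j, i), rfl⟩, normalized_nonneg (nII A j) i⟩
  let t := s.splitting lo w
  have hserved : ∀ A, ∀ j ∈ I.clients A, (t.FirstServed A j ↔ 1 ≤ ∑ i, s.doubleI A j i) := by
    intro A j hj
    rw [Sol.FirstServed, Fintype.sum_sum_type, Fintype.sum_prod_type,
      Finset.sum_eq_zero (s := (Finset.univ : Finset (F × K)))
        (fun q _ => Sol.splitting_xI_inr hw A q j), add_zero]
    simp only [t, Sol.splitting_xI_inl hw, hxI A _ j hj]
  -- The two parts add up to `2 * x`, of total at least 2; if the first is below 1, the second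
  -- exceeds 1.
  have hserved' : ∀ A, ∀ j ∈ I.clients A, ¬ t.FirstServed A j → 1 ≤ ∑ i, s.doubleII A j i := by
    intro A j hj hf
    rw [hserved A j hj, not_le] at hf
    simp only [Sol.doubleII, Finset.sum_sub_distrib, ← Finset.mul_sum]
    linarith [hs.covered A j hj]
  let proj : F × K ⊕ F × K → F := Sum.elim Prod.fst Prod.fst
  -- For active clients, a normalized threshold is at most the assignment and hence at most the
  -- opening, so each selected piece is fully assigned and fully opened in that stage.
  let cand : S × C → Finset (F × K ⊕ F × K) := fun p =>
    if t.FirstServed p.1 p.2 then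
      (Finset.univ.filter fun q : F × K => lo q.2 < normalized (s.doubleI p.1 p.2) q.1).map
        Function.Embedding.inl
    else
      (Finset.univ.filter fun q : F × K => lo q.2 < normalized (s.doubleII p.1 p.2) q.1).map
        Function.Embedding.inr
  let ρ : S × C → ℝ := fun q => I.radius proj (cand q) q.2
  obtain ⟨l, hl1, hl2, hl3⟩ := exists_sorted_list ρ
    (Finset.univ.filter fun q => q.2 ∈ I.clients q.1 ∧ t.FirstServed q.1 q.2)
  choose l' hl1' hl2' hl3' using fun A : S => exists_sorted_list ρ
    (Finset.univ.filter fun q => q.1 = A ∧ q.2 ∈ I.clients A ∧ ¬ t.FirstServed A q.2)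
  refine ⟨F × K ⊕ F × K, inferInstance, ⟨{
    proj := proj
    t := t
    split := isScaledSplit hs hw hw1 hyI hyII hxI hxII
    cand := cand
    candI_sum := fun A j hj hf => ?_
    candI_mem := fun A j hj hf g hg => ?_
    candII_sum := fun A j hj hf => ?_
    candII_mem := fun A j hj hf g hg => ?_
    orderI := l
    orderI_nodup := hl1
    orderI_mem := fun q => by simpa using hl2 q
    orderI_sorted := hl3
    orderII := l'
    orderII_nodup := hl1'
    orderII_mem := fun A q => by simpa using hl2' A q
    orderII_sorted := hl3' }⟩⟩
  · simp only [cand, if_pos hf, Finset.sum_map]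
    simp only [Function.Embedding.inl_apply, t, Sol.splitting_xI_inl hw]
    exact sum_layer_normalized (nI A j hj) ((hserved A j hj).1 hf) fun i => hnI A i j hj
  · simp only [cand, if_pos hf, Finset.mem_map, Finset.mem_filter, Finset.mem_univ,
      true_and] at hg
    obtain ⟨q, hq, rfl⟩ := hg
    have h1 := hq.trans_le (normalized_le (nI A j hj) ((hserved A j hj).1 hf) q.1)
    rw [Function.Embedding.inl_apply, Sol.splitting_xI_inl hw, layer_eq_of_lt h1]
    exact ⟨hw _, (layer_eq_of_lt (h1.trans_le (min_le_right _ _))).symm⟩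
  · simp only [cand, if_neg hf, Finset.sum_map]
    simp only [Function.Embedding.inr_apply, t, Sol.splitting_xII_inr hw]
    exact sum_layer_normalized (nII A j) (hserved' A j hj hf) fun i => hnII A i j hj
  · simp only [cand, if_neg hf, Finset.mem_map, Finset.mem_filter, Finset.mem_univ,
      true_and] at hg
    obtain ⟨q, hq, rfl⟩ := hg
    have h1 := hq.trans_le (normalized_le (nII A j) (hserved' A j hj hf) q.1)
    rw [Function.Embedding.inr_apply, Sol.splitting_xII_inr hw, layer_eq_of_lt h1]
    exact ⟨hw _, (layer_eq_of_lt (h1.trans_le (doubleII_le hs hj q.1))).symm⟩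

end Existence

end StochUFL

theorem mainTheorem3 {F C S : Type u} [Fintype F] [Fintype C] [Fintype S]
    [DecidableEq F] [DecidableEq C] [DecidableEq S] {X : Type v} [PseudoMetricSpace X]
    (I : StochUFL.Problem F C S X) (s : StochUFL.Sol F C S) (hs : I.PrimalOptimal s) :
    -- the algorithm can always be carried out
    (∃ (G : Type u) (_ : Fintype G), Nonempty (StochUFL.Execution I s G)) ∧
    ∀ (G : Type u) [Fintype G] [DecidableEq G] (R : StochUFL.Execution I s G),
      -- with probability one, every active client can be connected
      (∀ (A : S) (ω₁ : StochUFL.Draws G R.centersI) (ω₂ : StochUFL.Draws G (R.centersII A)),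
        0 < R.probI ω₁ → 0 < R.probII A ω₂ → ∀ j ∈ I.clients A,
          (R.openI ω₁ ∪ R.openII A ω₂).Nonempty) ∧
      -- the per-scenario bound
      (∀ d : StochUFL.DualSol F C S, I.DualOptimal d → ∀ A : S, 0 < I.prob A →
        R.expCostIn A ≤ 3 * Real.exp (-2) * I.budget d A
          + (1 - Real.exp (-2)) * I.conCost s A + 2 * I.facCost s A) ∧
      -- the bound on the expected cost
      R.expCost ≤ (2 + 3 * Real.exp (-2)) * I.totalFac s
        + (1 + 2 * Real.exp (-2)) * I.totalCon s ∧
      (2 + 3 * Real.exp (-2)) * I.totalFac s + (1 + 2 * Real.exp (-2)) * I.totalCon s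
        ≤ 2.4061 * I.totalFac s + 1.2707 * I.totalCon s := by
  refine ⟨StochUFL.exists_execution hs.1, fun G _ _ R => ⟨fun A ω₁ ω₂ h₁ h₂ j hj => ?_,
    fun d hd A hA => R.expCostIn_le_of_dual hs.1 hd.1 (I.le_budget_of_dualOptimal hs hd) hA,
    R.expCost_le hs, ?_⟩⟩
  -- Only existence matters here, so the crude radius `∑ i, c i j` suffices.
  · obtain ⟨i, hi, -⟩ := R.exists_open_c_le hj (r := ∑ i, I.c i j) (fun i _ =>
      Finset.single_le_sum (f := fun i => I.c i j) (fun i _ => I.c_nonneg i j)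
        (Finset.mem_univ i)) h₁.ne' h₂.ne'
    exact ⟨i, hi⟩
  · have h1 := StochUFL.exp_neg_two_lt
    have h2 := StochUFL.Problem.totalFac_nonneg hs.1
    have h3 := StochUFL.Problem.totalCon_nonneg hs.1
    exact add_le_add (mul_le_mul_of_nonneg_right (by linarith) h2)
      (mul_le_mul_of_nonneg_right (by linarith) h3)
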